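/- For a positive integer $N$ let $V=\{1,\dots,N\}$, $V_1=\{1,\dots,\lfloor N/2\rfloor\}$, and partition $V_1$ into the blocks $D_k=\{\lfloor (k-1)N/6\rfloor+1,\dots,\lfloor kN/6\rfloor\}$, $k=1,2,3$. Let $\kappa_N\le |V_1|$ be a sequence of nonnegative integers with $\lim_{N\to\infty}\kappa_N/\sqrt N=\infty$. Draw a random 3-uniform hypergraph $G$ on $V$ as follows: first include each unordered triple of distinct vertices as a hyper-edge independently with probability $1/2$; then, independently, choose a uniformly random subset $C\subseteq V_1$ of size $\kappa_N$, and add all triples of distinct vertices of $C$ as hyper-edges. Let $\mathbf A\in\{0,1\}^{N\times N\times N}$ be the adjacency tensor of $G$ ($A_{ijl}=1$ if and only if $\{i,j,l\}$ is a hyper-edge), and let $\mathbf A_{[D_1,D_2,D_3]}$ be its restriction to $D_1\times D_2\times D_3$. For $k=1,2,3$ let $\mathcal M_k$ denote the mode-$k$ matricization (rows indexed by the $k$-th index of the tensor, columns by the pair of the other two indices), let $\mathbf 1$ be the $|D_1|\times|D_2|\times|D_3|$ tensor with all entries $1$, and (for $N\ge 6$, so that all $D_k$ are non-empty) let $\hat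 u_k=\hat u_k(G)\in\mathbb R^{|D_k|}$ be any choice of leading left singular vector of $\mathcal M_k\big(2\,\mathbf A_{[D_1,D_2,D_3]}-\mathbf 1\big)$, that is, a unit left singular vector for the largest singular value. Let $(1_C)_{D_k}\in\mathbb R^{|D_k|}$ be the indicator vector of $C$ restricted to $D_k$, and for vectors $u,v\neq 0$ let $\Theta(u,v)=\arccos\frac{|\langle u,v\rangle|}{\|u\|\,\|v\|}\in[0,\pi/2]$ (with $\Theta(u,v)=\pi/2$ if $u=0$ or $v=0$). Then, for each $k=1,2,3$, $$\sin\Theta\big(\hat u_k,(1_C)_{D_k}\big)\xrightarrow{\ d\ }0\qquad\text{as }N\to\infty,$$ and the angle $\Theta\big(\hat u_k,(1_C)_{D_k}\big)$ tends to $0$ in probability: $\mathbb P\big(\Theta(\hat u_k,(1_C)_{D_k})\ge\varepsilon\big)\to 0$ for every $\varepsilon>0$. -/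

import Mathlib

open Filter Topology MeasureTheory ProbabilityTheory

noncomputable section

namespace PlantedClique

/-! ### Hypergraphs, the vertex blocks, and the planted clique model

The vertex set `{1, …, N}` is `Fin N`, the vertex `i + 1` being `i : Fin N`; the modes
`1, 2, 3` are the elements `0, 1, 2` of `Fin 3`. -/

/-- The possible hyper-edges: unordered triples of distinct vertices. -/
abbrev Triple (N : ℕ) : Type := {e : Finset (Fin N) // e.card = 3}

/-- A 3-hypergraph on the vertices `Fin N`, given by its set of hyper-edges. -/
abbrev Hypergraph3 (N : ℕ) : Type := Set (Triple N)

/-- `V₁ = {1, …, ⌊N/2⌋}`, the first half of the vertices. -/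
def firstHalf (N : ℕ) : Finset (Fin N) :=
  Finset.univ.filter fun i => i.val < N / 2

/-- The blocks `{⌊kN/6⌋ + 1, …, ⌊(k+1)N/6⌋}`, `k = 0, 1, 2`, that partition `V₁`. -/
def block (N : ℕ) (k : Fin 3) : Finset (Fin N) :=
  Finset.univ.filter fun i => k.val * N / 6 ≤ i.val ∧ i.val < (k.val + 1) * N / 6

/-- The Erdős–Rényi law `𝒢₃(N, 1/2)`: every triple is a hyper-edge independently with
probability `1/2`. -/
def erdosRenyi (N : ℕ) : Measure (Hypergraph3 N) :=
  setBernoulli (Set.univ : Set (Triple N)) ⟨1 / 2, by norm_num, by norm_num⟩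

instance (N : ℕ) : IsProbabilityMeasure (erdosRenyi N) := by
  unfold erdosRenyi; infer_instance

/-- The law of a uniformly random subset of `V` of size `κ`. -/
def cliqueLaw {N : ℕ} (κ : ℕ) (V : Finset (Fin N)) (h : κ ≤ V.card) :
    Measure (Finset (Fin N)) :=
  (PMF.uniformOfFinset (V.powersetCard κ) (Finset.powersetCard_nonempty.2 h)).toMeasure

instance {N : ℕ} (κ : ℕ) (V : Finset (Fin N)) (h : κ ≤ V.card) :
    IsProbabilityMeasure (cliqueLaw κ V h) := by
  unfold cliqueLaw; infer_instance

/-- Plant a clique on `C`: add to the hypergraph all triples contained in `C`. -/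
def plant {N : ℕ} (G₀ : Hypergraph3 N) (C : Finset (Fin N)) : Hypergraph3 N :=
  G₀ ∪ {e | e.val ⊆ C}

/-- The probability space underlying `𝒢₃(N, 1/2, κ, V)`. A sample is a pair `(G₀, C)` consisting
of an Erdős–Rényi hypergraph `G₀` and, independently, a uniformly random `κ`-subset `C` of `V`;
the random hypergraph with the planted clique is `plant G₀ C`. -/
def plantedMeasure {N : ℕ} (κ : ℕ) (V : Finset (Fin N)) (h : κ ≤ V.card) :
    Measure (Hypergraph3 N × Finset (Fin N)) :=
  (erdosRenyi N).prod (cliqueLaw κ V h)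

instance {N : ℕ} (κ : ℕ) (V : Finset (Fin N)) (h : κ ≤ V.card) :
    IsProbabilityMeasure (plantedMeasure κ V h) := by
  unfold plantedMeasure; infer_instance

/-! ### Tensors of order three -/

/-- Real tensors of order three whose `m`-th index ranges over `α m`. -/
abbrev Tensor3 (α : Fin 3 → Type) : Type := (∀ m, α m) → ℝ

open Classical in
/-- The adjacency tensor: `A t = 1` if `{t 0, t 1, t 2}` is a hyper-edge (in particular the three
vertices are distinct), and `A t = 0` otherwise. -/
def adjacencyTensor {N : ℕ} (G : Hypergraph3 N) : Tensor3 (fun _ => Fin N) :=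
  fun t => if ∃ e ∈ G, e.val = {t 0, t 1, t 2} then 1 else 0

/-- The subtensor `A_{[D 0, D 1, D 2]}`. -/
def subtensor {N : ℕ} (A : Tensor3 (fun _ => Fin N)) (D : Fin 3 → Finset (Fin N)) :
    Tensor3 (fun m => D m) :=
  fun t => A fun m => (t m : Fin N)

/-- Mode-`k` matricization: the rows are indexed by the `k`-th index of the tensor, the columns by
the pair of the two other indices. -/
def matricization {α : Fin 3 → Type} (k : Fin 3) (X : Tensor3 α) :
    Matrix (α k) (∀ m : {m : Fin 3 // m ≠ k}, α m) ℝ :=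
  Matrix.of fun i c => X ((Equiv.piSplitAt k α).symm (i, c))

/-- The matrix `ℳ_k(2 A_{[D₁, D₂, D₃]} - 1)` of a hypergraph. -/
def signMatrix {N : ℕ} (k : Fin 3) (G : Hypergraph3 N) :
    Matrix (block N k) (∀ m : {m : Fin 3 // m ≠ k}, block N m) ℝ :=
  matricization k fun t => 2 * subtensor (adjacencyTensor G) (block N) t - 1

/-! ### Singular vectors and the angle between lines -/

/-- The largest singular value `σ₁(M) = max ‖M v‖ / ‖v‖` of a real matrix. -/
def topSingularValue {m n : Type} [Fintype m] [Fintype n] [DecidableEq n] (M : Matrix m n ℝ) : ℝ :=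
  ‖(Matrix.toEuclideanLin M).toContinuousLinearMap‖

/-- `u` is a leading left singular vector of `M`: a unit vector such that, for some unit vector
`v`, `M v = σ u` and `Mᵀ u = σ v`, where `σ` is the largest singular value of `M`. -/
def IsLeadingLeftSingularVector {m n : Type} [Fintype m] [Fintype n] [DecidableEq m]
    [DecidableEq n] (M : Matrix m n ℝ) (u : EuclideanSpace ℝ m) : Prop :=
  ‖u‖ = 1 ∧ ∃ v : EuclideanSpace ℝ n, ‖v‖ = 1 ∧
    Matrix.toEuclideanLin M v = topSingularValue M • u ∧
    Matrix.toEuclideanLin M.transpose u = topSingularValue M • v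

/-- The principal angle in `[0, π/2]` between the lines spanned by two nonzero vectors (`π/2` if
one of the vectors is `0`). -/
def principalAngle {m : Type} [Fintype m] (u v : EuclideanSpace ℝ m) : ℝ :=
  Real.arccos (|inner ℝ u v| / (‖u‖ * ‖v‖))

/-- The `sin Θ` distance between the lines spanned by two vectors. -/
def sinTheta {m : Type} [Fintype m] (u v : EuclideanSpace ℝ m) : ℝ :=
  Real.sin (principalAngle u v)

/-- The restriction `(1_C)_D` to `D` of the indicator vector of `C`. -/
def cliqueIndicator {N : ℕ} (C D : Finset (Fin N)) : EuclideanSpace ℝ D :=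
  WithLp.toLp 2 fun i => if (i : Fin N) ∈ C then 1 else 0

end PlantedClique

end

namespace PlantedClique

/-! ### Rademacher sums indexed by a random set -/

/-! Since the three blocks are disjoint, the entries of the matricization belong to distinct
triples. The sign matrix M (with column set J) therefore has independent fair signs, except that it
is identically 1 on a block A × B formed by the clique rows and clique columns. The mean of M Mᵀ is
|J| I + |B| (1_A 1_Aᵀ − I_A), which singles out the direction 1_A, and `noiseForm` is the quadratic
form of the deviation from this mean.

A leading left singular vector u maximizes ‖Mᵀx‖ over unit x. Comparing it with a = 1_A / √|A| gives
`sinTheta_sq_le`: sin²Θ ≤ 1/|A| + (noise(u) − noise(a)) / (|A||B|). As u depends on the hypergraph,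
noise must be bounded above on the whole unit ball, but below only at the fixed vector a.

Both bounds come from exponential moments. A quadratic polynomial in a Rademacher sum is integrated
one sign at a time (`sum_weight_exp_quadratic_le`), then the columns are multiplied together
(`sum_exp_noiseForm_le`); for a unit vector the variance proxy is of order |J| + |A||B| ≤ N² + κ³.
For uniformity, the noise form has zero diagonal, hence is affine in each coordinate, so a scaled
vector can be rounded to an integer vector without decreasing the form (`exists_integerNet_ge`). At
most 48^N integer vectors occur, so the supremum is of order √N · √(N² + κ³), up to a term of order
N.

Chebyshev's inequality for the hypergeometric law shows that the clique meets every block in more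
than κ/12 vertices with probability at least 1 − 72/κ (`cliqueLaw_not_isBalanced_le`). Then |A||B|
is of order κ³, which dominates the noise because κ/√N → ∞ (`eventually_exists_tilt`). -/

open Classical in
/-- The sign `1` if `e ∈ G`, and `-1` otherwise. -/
noncomputable def memSign {E : Type*} (G : Set E) (e : E) : ℝ := if e ∈ G then 1 else -1

lemma memSign_symmDiff_self {E : Type*} (G : Set E) (e : E) :
    memSign (symmDiff G {e}) e = -memSign G e := by
  by_cases h : e ∈ G <;> simp [memSign, Set.mem_symmDiff, h]

lemma memSign_symmDiff_of_ne {E : Type*} (G : Set E) {e f : E} (h : f ≠ e) :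
    memSign (symmDiff G {e}) f = memSign G f := by
  have : f ∈ symmDiff G {e} ↔ f ∈ G := by simp [Set.mem_symmDiff, h]
  classical
  exact if_congr this rfl rfl

/-- Toggling one element is an involution of the sample space. This invariance of the counting
measure plays the role of independence and symmetry of the signs. -/
lemma sum_symmDiff_singleton {E : Type*} [Fintype E] (e : E) (F : Set E → ℝ) :
    ∑ G, F (symmDiff G {e}) = ∑ G, F G :=
  Equiv.sum_comp (symmDiff_left_involutive ({e} : Set E)).toPerm F

/-- The Rademacher sum `∑ i ∈ s, v i * (± 1)`. -/
noncomputable def signSum {E ι : Type*} (σ : ι → E) (v : ι → ℝ) (s : Finset ι) (G : Set E) : ℝ :=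
  ∑ i ∈ s, v i * memSign G (σ i)

lemma signSum_symmDiff {E ι : Type*} {σ : ι → E} (v : ι → ℝ) {s : Finset ι} {e : E}
    (he : ∀ i ∈ s, σ i ≠ e) (G : Set E) :
    signSum σ v s (symmDiff G {e}) = signSum σ v s G :=
  Finset.sum_congr rfl fun i hi => by rw [memSign_symmDiff_of_ne G (he i hi)]

/-- Integrating out one sign of a Rademacher sum against a weight that does not depend on it. -/
lemma sum_weight_signSum_insert {E ι : Type*} [Fintype E] [DecidableEq ι] {σ : ι → E}
    (hσ : Function.Injective σ) (v : ι → ℝ) {s : Finset ι} {a : ι} (ha : a ∉ s) {w : Set E → ℝ}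
    (hw : ∀ G, w (symmDiff G {σ a}) = w G) (f : ℝ → ℝ) :
    ∑ G, w G * f (signSum σ v (insert a s) G) =
      ∑ G, w G * ((f (signSum σ v s G + v a) + f (signSum σ v s G - v a)) / 2) := by
  have hflip := sum_symmDiff_singleton (σ a) fun G => w G * f (signSum σ v (insert a s) G)
  have hs : ∀ G, signSum σ v s (symmDiff G {σ a}) = signSum σ v s G :=
    signSum_symmDiff v fun i hi h => ha (hσ h ▸ hi)
  have key : ∀ G, w (symmDiff G {σ a}) * f (signSum σ v (insert a s) (symmDiff G {σ a})) +
      w G * f (signSum σ v (insert a s) G) =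
      2 * (w G * ((f (signSum σ v s G + v a) + f (signSum σ v s G - v a)) / 2)) := by
    intro G
    have h1 : ∀ G, signSum σ v (insert a s) G = signSum σ v s G + v a * memSign G (σ a) :=
      fun G => by simp [signSum, Finset.sum_insert ha, add_comm]
    rw [h1, h1, hs, hw, memSign_symmDiff_self]
    by_cases h : σ a ∈ G
    · simp only [memSign, h, if_true]; ring_nf
    · simp only [memSign, h, if_false]; ring_nf
  have := Finset.sum_congr rfl fun G (_ : G ∈ Finset.univ) => key G
  rw [Finset.sum_add_distrib, ← Finset.mul_sum] at this
  linarith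

/-- The average equals exp(lz² + tz + lv²) cosh((2lz + t)v), and cosh y ≤ exp(y²/2) makes the
exponent quadratic in z again. Quadratic exponents are thus stable under integrating out a sign,
with updated coefficients. No sign of l is assumed, so the lower tail uses it too. -/
lemma exp_quadratic_average_le (l t v z : ℝ) :
    (Real.exp (l * (z + v) ^ 2 + t * (z + v)) + Real.exp (l * (z - v) ^ 2 + t * (z - v))) / 2 ≤
      Real.exp (l * v ^ 2 + t ^ 2 * v ^ 2 / 2) *
        Real.exp ((l + 2 * l ^ 2 * v ^ 2) * z ^ 2 + (t + 2 * l * t * v ^ 2) * z) := by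
  have h := Real.cosh_le_exp_half_sq (2 * l * z * v + t * v)
  rw [Real.cosh_eq] at h
  have h1 : Real.exp (l * (z + v) ^ 2 + t * (z + v)) =
      Real.exp (l * z ^ 2 + t * z + l * v ^ 2) * Real.exp (2 * l * z * v + t * v) := by
    rw [← Real.exp_add]; ring_nf
  have h2 : Real.exp (l * (z - v) ^ 2 + t * (z - v)) =
      Real.exp (l * z ^ 2 + t * z + l * v ^ 2) * Real.exp (-(2 * l * z * v + t * v)) := by
    rw [← Real.exp_add]; ring_nf
  have h3 : Real.exp (l * v ^ 2 + t ^ 2 * v ^ 2 / 2) *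
        Real.exp ((l + 2 * l ^ 2 * v ^ 2) * z ^ 2 + (t + 2 * l * t * v ^ 2) * z) =
      Real.exp (l * z ^ 2 + t * z + l * v ^ 2) *
        Real.exp ((2 * l * z * v + t * v) ^ 2 / 2) := by
    rw [← Real.exp_add, ← Real.exp_add]; ring_nf
  rw [h1, h2, h3, ← mul_add, mul_div_assoc]
  exact mul_le_mul_of_nonneg_left h (Real.exp_pos _).le

/-- Closes the induction on the signs. The Gaussian value (1 − 2lS)^(−1/2) exp(t²S / (2(1 − 2lS)))
is relaxed to exp((lS + t²S/2) / (1 − 2lS)), a form which survives the coefficient update. The key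
inequality is (1 + 2lx)(1 − 2lx) ≤ 1 with x = v². -/
lemma quadratic_exponent_step {l t v S : ℝ} (hl : 0 ≤ l) (hS : 0 ≤ S)
    (h : 2 * l * (v ^ 2 + S) < 1) :
    l * v ^ 2 + t ^ 2 * v ^ 2 / 2 +
      ((l + 2 * l ^ 2 * v ^ 2) * S + (t + 2 * l * t * v ^ 2) ^ 2 * S / 2) /
        (1 - 2 * (l + 2 * l ^ 2 * v ^ 2) * S) ≤
      (l * (v ^ 2 + S) + t ^ 2 * (v ^ 2 + S) / 2) / (1 - 2 * l * (v ^ 2 + S)) := by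
  obtain ⟨x, hx⟩ : ∃ x, x = v ^ 2 := ⟨_, rfl⟩
  rw [← hx] at h ⊢
  have hx0 : 0 ≤ x := hx ▸ sq_nonneg v
  have hlx : 0 ≤ l * x := mul_nonneg hl hx0
  have hlS : 0 ≤ l * S := mul_nonneg hl hS
  have hD : 0 < 1 - 2 * l * (x + S) := by linarith
  have h1x : 0 < 1 - 2 * l * x := by nlinarith
  have hq : (1 + 2 * l * x) * (1 - 2 * l * x) ≤ 1 := by nlinarith [sq_nonneg (l * x)]
  have hD' : 1 - 2 * l * (x + S) ≤ (1 - 2 * (l + 2 * l ^ 2 * x) * S) * (1 - 2 * l * x) := by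
    have : (1 - 2 * (l + 2 * l ^ 2 * x) * S) * (1 - 2 * l * x) =
      (1 - 2 * l * x) - 2 * (l * S) * ((1 + 2 * l * x) * (1 - 2 * l * x)) := by ring
    nlinarith
  have hD'' : 0 < 1 - 2 * (l + 2 * l ^ 2 * x) * S :=
    pos_of_mul_pos_left (hD.trans_le hD') h1x.le
  have hfrac : ((l + 2 * l ^ 2 * x) * S + (t + 2 * l * t * x) ^ 2 * S / 2) /
        (1 - 2 * (l + 2 * l ^ 2 * x) * S) ≤
      (l * S + t ^ 2 * S / 2 * (1 + 2 * l * x)) / (1 - 2 * l * (x + S)) := by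
    rw [div_le_div_iff₀ hD'' hD]
    have e1 : (l + 2 * l ^ 2 * x) * S + (t + 2 * l * t * x) ^ 2 * S / 2 =
      (1 + 2 * l * x) * (l * S + t ^ 2 * S / 2 * (1 + 2 * l * x)) := by ring
    have hP : 0 ≤ l * S + t ^ 2 * S / 2 * (1 + 2 * l * x) := by positivity
    have hq0 : 0 < 1 + 2 * l * x := by positivity
    rw [e1]
    calc _ ≤ (1 + 2 * l * x) * (l * S + t ^ 2 * S / 2 * (1 + 2 * l * x)) *
          ((1 - 2 * (l + 2 * l ^ 2 * x) * S) * (1 - 2 * l * x)) := by gcongr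
      _ = ((1 + 2 * l * x) * (1 - 2 * l * x)) * ((l * S + t ^ 2 * S / 2 * (1 + 2 * l * x)) *
          (1 - 2 * (l + 2 * l ^ 2 * x) * S)) := by ring
      _ ≤ 1 * _ := by gcongr
      _ = _ := one_mul _
  refine (add_le_add_right hfrac _).trans ?_
  rw [le_div_iff₀ hD, add_mul, div_mul_cancel₀ _ hD.ne']
  have hi : 0 ≤ t ^ 2 * (l * x) * x := by positivity
  have hj : 0 ≤ l * x * (l * x) := by positivity
  have hk : 0 ≤ l * x * (l * S) := by positivity
  nlinarith

/-- Moment generating function of a quadratic polynomial in a Rademacher sum. -/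
lemma sum_weight_exp_quadratic_le {E ι : Type*} [Fintype E] [DecidableEq ι] {σ : ι → E}
    (hσ : Function.Injective σ) (v : ι → ℝ) {w : Set E → ℝ} (hw0 : ∀ G, 0 ≤ w G)
    (s : Finset ι) (hw : ∀ i ∈ s, ∀ G, w (symmDiff G {σ i}) = w G) {l : ℝ} (t : ℝ) (hl : 0 ≤ l)
    (hls : 2 * l * ∑ i ∈ s, v i ^ 2 < 1) :
    ∑ G, w G * Real.exp (l * signSum σ v s G ^ 2 + t * signSum σ v s G) ≤
      Real.exp ((l * ∑ i ∈ s, v i ^ 2 + t ^ 2 * (∑ i ∈ s, v i ^ 2) / 2) /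
        (1 - 2 * l * ∑ i ∈ s, v i ^ 2)) * ∑ G, w G := by
  induction s using Finset.induction_on generalizing l t with
  | empty => simp [signSum]
  | insert a s ha ih =>
    rw [sum_weight_signSum_insert hσ v ha (hw a (Finset.mem_insert_self a s))
      fun z => Real.exp (l * z ^ 2 + t * z)]
    rw [Finset.sum_insert ha] at hls ⊢
    set S := ∑ i ∈ s, v i ^ 2
    have hS : 0 ≤ S := Finset.sum_nonneg fun i _ => sq_nonneg _
    have hl' : 0 ≤ l + 2 * l ^ 2 * v a ^ 2 := by positivity
    have hls' : 2 * (l + 2 * l ^ 2 * v a ^ 2) * S < 1 := by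
      have h1 : 0 ≤ l * v a ^ 2 := by positivity
      have h2 : 0 ≤ l * S := by positivity
      nlinarith
    calc _ ≤ ∑ G, w G * (Real.exp (l * v a ^ 2 + t ^ 2 * v a ^ 2 / 2) *
          Real.exp ((l + 2 * l ^ 2 * v a ^ 2) * signSum σ v s G ^ 2 +
            (t + 2 * l * t * v a ^ 2) * signSum σ v s G)) :=
          Finset.sum_le_sum fun G _ => mul_le_mul_of_nonneg_left
            (exp_quadratic_average_le l t (v a) _) (hw0 G)
      _ = Real.exp (l * v a ^ 2 + t ^ 2 * v a ^ 2 / 2) * ∑ G, w G *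
          Real.exp ((l + 2 * l ^ 2 * v a ^ 2) * signSum σ v s G ^ 2 +
            (t + 2 * l * t * v a ^ 2) * signSum σ v s G) := by
          rw [Finset.mul_sum]; exact Finset.sum_congr rfl fun G _ => by ring
      _ ≤ Real.exp (l * v a ^ 2 + t ^ 2 * v a ^ 2 / 2) * (Real.exp _ * ∑ G, w G) :=
          mul_le_mul_of_nonneg_left
            (ih (fun i hi => hw i (Finset.mem_insert_of_mem hi)) _ hl' hls') (Real.exp_pos _).le
      _ ≤ _ := by
          rw [← mul_assoc, ← Real.exp_add]
          exact mul_le_mul_of_nonneg_right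
            (Real.exp_le_exp.2 (quadratic_exponent_step hl hS hls))
            (Finset.sum_nonneg fun G _ => hw0 G)

/-- Lower tail counterpart of `sum_weight_exp_quadratic_le`. -/
lemma sum_weight_exp_neg_sq_le {E ι : Type*} [Fintype E] [DecidableEq ι] {σ : ι → E}
    (hσ : Function.Injective σ) (v : ι → ℝ) {w : Set E → ℝ} (hw0 : ∀ G, 0 ≤ w G)
    (s : Finset ι) (hw : ∀ i ∈ s, ∀ G, w (symmDiff G {σ i}) = w G) {l : ℝ} (hl : 0 ≤ l)
    (hls : 2 * l * ∑ i ∈ s, v i ^ 2 ≤ 1) :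
    ∑ G, w G * Real.exp (-l * signSum σ v s G ^ 2) ≤
      Real.exp (-l * ∑ i ∈ s, v i ^ 2 + l ^ 2 * (∑ i ∈ s, v i ^ 2) ^ 2) * ∑ G, w G := by
  induction s using Finset.induction_on generalizing l with
  | empty => simp [signSum]
  | insert a s ha ih =>
    rw [sum_weight_signSum_insert hσ v ha (hw a (Finset.mem_insert_self a s))
      fun z => Real.exp (-l * z ^ 2)]
    rw [Finset.sum_insert ha] at hls ⊢
    set S := ∑ i ∈ s, v i ^ 2
    have hS : 0 ≤ S := Finset.sum_nonneg fun i _ => sq_nonneg _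
    have h1 : 0 ≤ l * v a ^ 2 := by positivity
    have h2 : 0 ≤ l * S := by positivity
    have hl' : 0 ≤ l - 2 * l ^ 2 * v a ^ 2 := by
      have : l - 2 * l ^ 2 * v a ^ 2 = l * (1 - 2 * (l * v a ^ 2)) := by ring
      rw [this]; exact mul_nonneg hl (by nlinarith)
    have hle : l - 2 * l ^ 2 * v a ^ 2 ≤ l := by nlinarith [mul_nonneg hl h1]
    have hls' : 2 * (l - 2 * l ^ 2 * v a ^ 2) * S ≤ 1 := by
      nlinarith [mul_nonneg hl h1, mul_le_mul_of_nonneg_right hle hS]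
    calc _ ≤ ∑ G, w G * (Real.exp (-l * v a ^ 2) *
          Real.exp (-(l - 2 * l ^ 2 * v a ^ 2) * signSum σ v s G ^ 2)) :=
          Finset.sum_le_sum fun G _ => mul_le_mul_of_nonneg_left (by
            have := exp_quadratic_average_le (-l) 0 (v a) (signSum σ v s G)
            ring_nf at this ⊢; exact this) (hw0 G)
      _ = Real.exp (-l * v a ^ 2) * ∑ G, w G *
          Real.exp (-(l - 2 * l ^ 2 * v a ^ 2) * signSum σ v s G ^ 2) := by
          rw [Finset.mul_sum]; exact Finset.sum_congr rfl fun G _ => by ring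
      _ ≤ Real.exp (-l * v a ^ 2) * (Real.exp _ * ∑ G, w G) :=
          mul_le_mul_of_nonneg_left
            (ih (fun i hi => hw i (Finset.mem_insert_of_mem hi)) hl' hls') (Real.exp_pos _).le
      _ ≤ _ := by
          rw [← mul_assoc, ← Real.exp_add]
          refine mul_le_mul_of_nonneg_right (Real.exp_le_exp.2 ?_)
            (Finset.sum_nonneg fun G _ => hw0 G)
          have h3 : (l - 2 * l ^ 2 * v a ^ 2) ^ 2 * S ^ 2 ≤ l ^ 2 * S ^ 2 := by gcongr
          nlinarith [mul_nonneg h1 h1]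

/-! ### The noise form of a sign matrix with a planted block -/

section NoiseForm

variable {E I J : Type*} [Fintype E] [Fintype I] [Fintype J] [DecidableEq I] [DecidableEq J]

/-- The random sign matrix whose entries on the block `A × B` are all `1`. -/
noncomputable def plantedSign (σ : I × J → E) (A : Finset I) (B : Finset J) (G : Set E)
    (i : I) (c : J) : ℝ :=
  if i ∈ A ∧ c ∈ B then 1 else memSign G (σ (i, c))

/-- The contribution of column `c` to the noise form. -/
noncomputable def columnForm (σ : I × J → E) (A : Finset I) (B : Finset J) (G : Set E)
    (x : I → ℝ) (c : J) : ℝ :=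
  (∑ i, x i * plantedSign σ A B G i c) ^ 2 - ∑ i, x i ^ 2 -
    if c ∈ B then (∑ i ∈ A, x i) ^ 2 - ∑ i ∈ A, x i ^ 2 else 0

/-- The quadratic form of `M Mᵀ` minus its mean. -/
noncomputable def noiseForm (σ : I × J → E) (A : Finset I) (B : Finset J) (G : Set E)
    (x : I → ℝ) : ℝ :=
  ∑ c, columnForm σ A B G x c

/-- The rows in which column `c` is random. -/
def freeRows (A : Finset I) (B : Finset J) (c : J) : Finset I :=
  if c ∈ B then Aᶜ else Finset.univ

/-- The sum of a vector over the planted rows of column `c`. -/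
noncomputable def plantedSum (A : Finset I) (B : Finset J) (x : I → ℝ) (c : J) : ℝ :=
  if c ∈ B then ∑ i ∈ A, x i else 0

-- Expanding (b + Z)² with b the deterministic planted part and Z the random part: b² cancels
-- against the planted mean, leaving the centred variable Z² − E Z² plus a linear term 2bZ.
omit [Fintype E] [Fintype J] in
lemma columnForm_eq (σ : I × J → E) (A : Finset I) (B : Finset J) (G : Set E)
    (x : I → ℝ) (c : J) :
    columnForm σ A B G x c =
      signSum (fun i => σ (i, c)) x (freeRows A B c) G ^ 2 +
        2 * plantedSum A B x c * signSum (fun i => σ (i, c)) x (freeRows A B c) G -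
        ∑ i ∈ freeRows A B c, x i ^ 2 := by
  by_cases hc : c ∈ B
  · have h1 : ∑ i, x i * plantedSign σ A B G i c =
        ∑ i ∈ A, x i + signSum (fun i => σ (i, c)) x Aᶜ G := by
      rw [← Finset.sum_add_sum_compl A, signSum]
      congr 1
      · exact Finset.sum_congr rfl fun i hi => by simp [plantedSign, hi, hc]
      · refine Finset.sum_congr rfl fun i hi => ?_
        rw [Finset.mem_compl] at hi
        simp [plantedSign, hi]
    have h2 := Finset.sum_add_sum_compl A fun i => x i ^ 2
    simp only [columnForm, freeRows, plantedSum, hc, if_true, h1]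
    rw [← h2]; ring
  · simp [columnForm, freeRows, plantedSum, hc, plantedSign, signSum]

omit [Fintype E] [Fintype J] in
lemma columnForm_symmDiff {σ : I × J → E} (hσ : Function.Injective σ) (A : Finset I)
    (B : Finset J) (x : I → ℝ) {c d : J} (hcd : c ≠ d) (i : I) (G : Set E) :
    columnForm σ A B (symmDiff G {σ (i, d)}) x c = columnForm σ A B G x c := by
  rw [columnForm_eq, columnForm_eq, signSum_symmDiff]
  intro j _ h
  exact hcd (congrArg Prod.snd (hσ h))

-- Columns use disjoint sets of signs, so the exponential weight of the columns already treated is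
-- unaffected by flips in a new column. This is the hypothesis on `w` in the weighted moment bounds.
omit [Fintype E] [Fintype J] in
lemma weight_symmDiff {σ : I × J → E} (hσ : Function.Injective σ) (A : Finset I)
    (B : Finset J) (x : I → ℝ) {T : Finset J} {d : J} (hd : d ∉ T) (l : ℝ) (i : I) (G : Set E) :
    Real.exp (l * ∑ c ∈ T, columnForm σ A B (symmDiff G {σ (i, d)}) x c) =
      Real.exp (l * ∑ c ∈ T, columnForm σ A B G x c) := by
  congr 2
  exact Finset.sum_congr rfl fun c hc =>
    columnForm_symmDiff hσ A B x (ne_of_mem_of_not_mem hc hd) i G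

omit [Fintype J] in
lemma sum_exp_columnForm_le {σ : I × J → E} (hσ : Function.Injective σ) (A : Finset I)
    (B : Finset J) (x : I → ℝ) {l s : ℝ} (hl : 0 ≤ l) (hx : ∑ i, x i ^ 2 ≤ s)
    (hls : 4 * l * s ≤ 1) (T : Finset J) :
    ∑ G : Set E, Real.exp (l * ∑ c ∈ T, columnForm σ A B G x c) ≤
      Real.exp (∑ c ∈ T, 4 * l ^ 2 * s * (s + plantedSum A B x c ^ 2)) *
        Fintype.card (Set E) := by
  induction T using Finset.induction_on with
  | empty => simp
  | insert d T hd ih =>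
    set w : Set E → ℝ := fun G => Real.exp (l * ∑ c ∈ T, columnForm σ A B G x c)
    set S := ∑ i ∈ freeRows A B d, x i ^ 2
    set b := plantedSum A B x d
    have hS : 0 ≤ S := Finset.sum_nonneg fun i _ => sq_nonneg _
    have hSs : S ≤ s := (Finset.sum_le_sum_of_subset_of_nonneg (Finset.subset_univ _)
      fun i _ _ => sq_nonneg _).trans hx
    have hs : 0 ≤ s := hS.trans hSs
    have hlS : l * S ≤ l * s := mul_le_mul_of_nonneg_left hSs hl
    have hinj : Function.Injective fun i => σ (i, d) := fun i j h => congrArg Prod.fst (hσ h)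
    have key := sum_weight_exp_quadratic_le hinj x (w := w) (fun G => (Real.exp_pos _).le)
      (freeRows A B d) (fun i _ G => weight_symmDiff hσ A B x hd l i G) (2 * l * b) hl
      (by change 2 * l * S < 1; linarith)
    change _ ≤ Real.exp ((l * S + (2 * l * b) ^ 2 * S / 2) / (1 - 2 * l * S)) * _ at key
    -- After centring by lS the left side is 2l²S(S + b²) / (1 − 2lS), and `hls` keeps the
    -- denominator at least 1/2.
    have hbound : (l * S + (2 * l * b) ^ 2 * S / 2) / (1 - 2 * l * S) - l * S ≤
        4 * l ^ 2 * s * (s + b ^ 2) := by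
      have hD : 0 < 1 - 2 * l * S := by linarith
      rw [sub_le_iff_le_add, div_le_iff₀ hD]
      have h1 : 4 * l ^ 2 * S * (S + b ^ 2) ≤ 4 * l ^ 2 * s * (s + b ^ 2) := by gcongr
      have h2 : 0 ≤ (4 * l ^ 2 * S * (S + b ^ 2)) * (1 / 2 - 2 * l * S) :=
        mul_nonneg (by positivity) (by linarith)
      have h3 := mul_le_mul_of_nonneg_right h1 hD.le
      nlinarith
    calc ∑ G : Set E, Real.exp (l * ∑ c ∈ insert d T, columnForm σ A B G x c)
        = Real.exp (-(l * S)) * ∑ G, w G * Real.exp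
          (l * signSum (fun i => σ (i, d)) x (freeRows A B d) G ^ 2 +
            2 * l * b * signSum (fun i => σ (i, d)) x (freeRows A B d) G) := by
          rw [Finset.mul_sum]
          refine Finset.sum_congr rfl fun G _ => ?_
          rw [Finset.sum_insert hd, columnForm_eq, ← Real.exp_add, ← Real.exp_add]
          congr 1; ring
      _ ≤ Real.exp (-(l * S)) * (Real.exp _ * ∑ G, w G) :=
          mul_le_mul_of_nonneg_left key (Real.exp_pos _).le
      _ = Real.exp ((l * S + (2 * l * b) ^ 2 * S / 2) / (1 - 2 * l * S) - l * S) *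
          ∑ G, w G := by rw [← mul_assoc, ← Real.exp_add]; ring_nf
      _ ≤ Real.exp (4 * l ^ 2 * s * (s + b ^ 2)) * (Real.exp
          (∑ c ∈ T, 4 * l ^ 2 * s * (s + plantedSum A B x c ^ 2)) * Fintype.card (Set E)) :=
          mul_le_mul (Real.exp_le_exp.2 hbound) ih
            (Finset.sum_nonneg fun G _ => (Real.exp_pos _).le) (Real.exp_pos _).le
      _ = _ := by rw [Finset.sum_insert hd, Real.exp_add]; ring

lemma sum_exp_noiseForm_le {σ : I × J → E} (hσ : Function.Injective σ) (A : Finset I)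
    (B : Finset J) (x : I → ℝ) {l s : ℝ} (hl : 0 ≤ l) (hx : ∑ i, x i ^ 2 ≤ s)
    (hls : 4 * l * s ≤ 1) :
    ∑ G : Set E, Real.exp (l * noiseForm σ A B G x) ≤
      Real.exp (4 * l ^ 2 * s ^ 2 * (Fintype.card J + A.card * B.card)) *
        Fintype.card (Set E) := by
  refine (sum_exp_columnForm_le hσ A B x hl hx hls Finset.univ).trans ?_
  refine mul_le_mul_of_nonneg_right (Real.exp_le_exp.2 ?_) (Nat.cast_nonneg _)
  have hs : 0 ≤ s := (Finset.sum_nonneg fun i _ => sq_nonneg _).trans hx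
  -- Cauchy–Schwarz on the planted rows: summed over the columns of B, the linear terms contribute
  -- the summand |A||B| of the variance proxy.
  have hb : ∀ c, plantedSum A B x c ^ 2 ≤ if c ∈ B then A.card * s else 0 := by
    intro c
    unfold plantedSum
    split_ifs
    · refine sq_sum_le_card_mul_sum_sq.trans (mul_le_mul_of_nonneg_left ?_ (Nat.cast_nonneg _))
      exact (Finset.sum_le_sum_of_subset_of_nonneg (Finset.subset_univ _)
        fun i _ _ => sq_nonneg _).trans hx
    · simp
  calc ∑ c, 4 * l ^ 2 * s * (s + plantedSum A B x c ^ 2)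
      ≤ ∑ c, 4 * l ^ 2 * s * (s + if c ∈ B then A.card * s else 0) :=
        Finset.sum_le_sum fun c _ =>
          mul_le_mul_of_nonneg_left (add_le_add_right (hb c) s) (by positivity)
    _ = _ := by
        rw [← Finset.mul_sum, Finset.sum_add_distrib, ← Finset.sum_filter]
        simp
        ring

omit [Fintype J] in
/-- Lower tail of the columns of the noise form for a vector supported on the planted rows. -/
lemma sum_exp_neg_columnForm_le {σ : I × J → E} (hσ : Function.Injective σ) (A : Finset I)
    (B : Finset J) (x : I → ℝ) (hxA : ∀ i ∉ A, x i = 0) {l s : ℝ} (hl : 0 ≤ l)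
    (hx : ∑ i, x i ^ 2 ≤ s) (hls : 2 * l * s ≤ 1) (T : Finset J) :
    ∑ G : Set E, Real.exp (-l * ∑ c ∈ T, columnForm σ A B G x c) ≤
      Real.exp (T.card * (l ^ 2 * s ^ 2)) * Fintype.card (Set E) := by
  induction T using Finset.induction_on with
  | empty => simp
  | insert d T hd ih =>
    -- The cross term vanishes: in a column of B the free rows lie outside the support of x, and in
    -- any other column the planted part is 0. Hence only the square has to be controlled.
    have hZ : ∀ G, plantedSum A B x d *
        signSum (fun i => σ (i, d)) x (freeRows A B d) G = 0 := by
      intro G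
      by_cases hdB : d ∈ B
      · have : signSum (fun i => σ (i, d)) x (freeRows A B d) G = 0 := by
          refine Finset.sum_eq_zero fun i hi => ?_
          simp only [freeRows, hdB, if_true, Finset.mem_compl] at hi
          simp [hxA i hi]
        rw [this, mul_zero]
      · simp [plantedSum, hdB]
    set w : Set E → ℝ := fun G => Real.exp (-l * ∑ c ∈ T, columnForm σ A B G x c)
    set S := ∑ i ∈ freeRows A B d, x i ^ 2
    have hS : 0 ≤ S := Finset.sum_nonneg fun i _ => sq_nonneg _
    have hSs : S ≤ s := (Finset.sum_le_sum_of_subset_of_nonneg (Finset.subset_univ _)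
      fun i _ _ => sq_nonneg _).trans hx
    have hlS : l * S ≤ l * s := mul_le_mul_of_nonneg_left hSs hl
    have hinj : Function.Injective fun i => σ (i, d) := fun i j h => congrArg Prod.fst (hσ h)
    have key := sum_weight_exp_neg_sq_le hinj x (w := w) (fun G => (Real.exp_pos _).le)
      (freeRows A B d) (fun i _ G => weight_symmDiff hσ A B x hd (-l) i G) hl
      (by change 2 * l * S ≤ 1; linarith)
    change _ ≤ Real.exp (-l * S + l ^ 2 * S ^ 2) * _ at key
    calc ∑ G : Set E, Real.exp (-l * ∑ c ∈ insert d T, columnForm σ A B G x c)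
        = Real.exp (l * S) * ∑ G, w G * Real.exp
          (-l * signSum (fun i => σ (i, d)) x (freeRows A B d) G ^ 2) := by
          rw [Finset.mul_sum]
          refine Finset.sum_congr rfl fun G _ => ?_
          rw [Finset.sum_insert hd, columnForm_eq, ← Real.exp_add, ← Real.exp_add]
          congr 1
          linear_combination -2 * l * hZ G
      _ ≤ Real.exp (l * S) * (Real.exp (-l * S + l ^ 2 * S ^ 2) * ∑ G, w G) :=
          mul_le_mul_of_nonneg_left key (Real.exp_pos _).le
      _ = Real.exp (l ^ 2 * S ^ 2) * ∑ G, w G := by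
          rw [← mul_assoc, ← Real.exp_add]; ring_nf
      _ ≤ Real.exp (l ^ 2 * s ^ 2) * (Real.exp (T.card * (l ^ 2 * s ^ 2)) *
          Fintype.card (Set E)) := by
          refine mul_le_mul (Real.exp_le_exp.2 (by gcongr)) ih
            (Finset.sum_nonneg fun G _ => (Real.exp_pos _).le) (Real.exp_pos _).le
      _ = _ := by
          rw [Finset.card_insert_of_notMem hd, ← mul_assoc, ← Real.exp_add]
          push_cast; ring_nf

end NoiseForm

/-! ### Tail bounds -/

/-- The exponential Markov inequality for the counting measure. -/
lemma card_filter_le_of_sum_exp_le {Ω : Type*} [Fintype Ω] (f : Ω → ℝ) (t R : ℝ)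
    (p : Ω → Prop) [DecidablePred p] (hp : ∀ x, p x → t ≤ f x)
    (h : ∑ x, Real.exp (f x) ≤ Real.exp R * Fintype.card Ω) :
    ((Finset.univ.filter p).card : ℝ) ≤ Real.exp (R - t) * Fintype.card Ω := by
  have h1 : ((Finset.univ.filter p).card : ℝ) * Real.exp t ≤ ∑ x, Real.exp (f x) := by
    rw [← nsmul_eq_mul]
    refine (Finset.card_nsmul_le_sum _ (fun x => Real.exp (f x)) _ fun x hx =>
      Real.exp_le_exp.2 (hp x (Finset.mem_filter.1 hx).2)).trans ?_
    exact Finset.sum_le_sum_of_subset_of_nonneg (Finset.filter_subset _ _)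
      fun x _ _ => (Real.exp_pos _).le
  rw [Real.exp_sub, div_mul_eq_mul_div, le_div_iff₀ (Real.exp_pos t)]
  exact h1.trans h

/-! ### Rounding to integer vectors -/

section Rounding

variable {I : Type*} [Fintype I] [DecidableEq I]

/-- A function which is affine in each coordinate is bounded on a box by its values at the
corners. -/
lemma exists_corner_ge (g : (I → ℝ) → ℝ)
    (hg : ∀ x i, ∃ a b : ℝ, ∀ t, g (Function.update x i t) = a + b * t)
    (lo hi y : I → ℝ) (hy : ∀ i, lo i ≤ y i ∧ y i ≤ hi i) :
    ∃ x : I → ℝ, (∀ i, x i = lo i ∨ x i = hi i) ∧ g y ≤ g x := by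
  suffices H : ∀ s : Finset I, ∃ x : I → ℝ, (∀ i ∈ s, x i = lo i ∨ x i = hi i) ∧
      (∀ i ∉ s, x i = y i) ∧ g y ≤ g x by
    obtain ⟨x, h1, -, h3⟩ := H Finset.univ
    exact ⟨x, fun i => h1 i (Finset.mem_univ i), h3⟩
  intro s
  induction s using Finset.induction_on with
  | empty => exact ⟨y, by simp, by simp, le_rfl⟩
  | insert j s hj ih =>
    obtain ⟨x, h1, h2, h3⟩ := ih
    obtain ⟨a, b, hab⟩ := hg x j
    have hx : g x = a + b * y j := by rw [← hab, ← h2 j hj, Function.update_eq_self]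
    obtain ⟨t, ht, hle⟩ : ∃ t, (t = lo j ∨ t = hi j) ∧ a + b * y j ≤ a + b * t := by
      rcases le_total 0 b with hb | hb
      · exact ⟨hi j, .inr rfl, by nlinarith [(hy j).2]⟩
      · exact ⟨lo j, .inl rfl, by nlinarith [(hy j).1]⟩
    refine ⟨Function.update x j t, fun i hi => ?_, fun i hi => ?_, ?_⟩
    · rcases eq_or_ne i j with rfl | hij
      · simpa using ht
      · simpa [hij] using h1 i ((Finset.mem_insert.1 hi).resolve_left hij)
    · rw [Finset.mem_insert, not_or] at hi
      simpa [hi.1] using h2 i hi.2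
    · rw [hab]; linarith

/-- Integer vectors of squared length at most `4 m`, where `m` is the dimension. -/
noncomputable def integerNet (I : Type*) [Fintype I] [DecidableEq I] : Finset (I → ℤ) :=
  (Fintype.piFinset fun _ : I =>
    Finset.Icc (-(4 * Fintype.card I : ℤ)) (4 * Fintype.card I)).filter
      fun x => ∑ i, x i ^ 2 ≤ 4 * Fintype.card I

lemma mem_integerNet {x : I → ℤ} : x ∈ integerNet I ↔ ∑ i, x i ^ 2 ≤ 4 * Fintype.card I := by
  rw [integerNet, Finset.mem_filter, and_iff_right_iff_imp]
  intro h
  rw [Fintype.mem_piFinset]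
  intro i
  have h1 : x i ^ 2 ≤ 4 * Fintype.card I :=
    (Finset.single_le_sum (f := fun i => x i ^ 2) (fun j _ => sq_nonneg _)
      (Finset.mem_univ i)).trans h
  rw [Finset.mem_Icc]
  constructor <;> nlinarith [Int.le_self_sq (x i), Int.le_self_sq (-x i)]

lemma sum_half_pow_natAbs_le (n : ℕ) :
    ∑ k ∈ Finset.Icc (-(n : ℤ)) n, (1 / 2 : ℝ) ^ k.natAbs ≤ 3 - 2 * (1 / 2) ^ n := by
  induction n with
  | zero => norm_num
  | succ n ih =>
    have : Finset.Icc (-((n + 1 : ℕ) : ℤ)) ((n + 1 : ℕ) : ℤ) =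
        insert ((n + 1 : ℕ) : ℤ) (insert (-((n + 1 : ℕ) : ℤ)) (Finset.Icc (-(n : ℤ)) n)) := by
      ext k; simp only [Finset.mem_Icc, Finset.mem_insert]; push_cast; omega
    rw [this, Finset.sum_insert, Finset.sum_insert, Int.natAbs_neg, Int.natAbs_natCast, pow_succ]
    · linarith
    · simp
    · simp only [Finset.mem_insert, Finset.mem_Icc]; push_cast; omega

/-- Give x the weight ∏ 2^(−|x_i|). On the net ∑ |x_i| ≤ ∑ x_i² ≤ 4m, so each weight is at least
16^(−m), while the total weight of the box is at most 3^m; 48 = 16 · 3. -/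
lemma card_integerNet_le : ((integerNet I).card : ℝ) ≤ 48 ^ Fintype.card I := by
  set m := Fintype.card I
  have h1 : ∀ x ∈ integerNet I, (1 : ℝ) ≤ 16 ^ m * ∏ i, (1 / 2 : ℝ) ^ (x i).natAbs := by
    intro x hx
    rw [mem_integerNet] at hx
    have h2 : ∑ i, (x i).natAbs ≤ 4 * m := by
      zify
      refine (Finset.sum_le_sum fun i _ => ?_).trans hx
      rw [← sq_abs]
      exact Int.le_self_sq _
    rw [Finset.prod_pow_eq_pow_sum]
    calc (1 : ℝ) = 16 ^ m * (1 / 2) ^ (4 * m) := by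
          rw [pow_mul, ← mul_pow]; norm_num
      _ ≤ _ := by
          gcongr ?_ * ?_
          exact pow_le_pow_of_le_one (by norm_num) (by norm_num) h2
  calc ((integerNet I).card : ℝ) = ∑ x ∈ integerNet I, 1 := by simp
    _ ≤ ∑ x ∈ integerNet I, 16 ^ m * ∏ i, (1 / 2 : ℝ) ^ (x i).natAbs := Finset.sum_le_sum h1
    _ ≤ ∑ x ∈ Fintype.piFinset fun _ : I => Finset.Icc (-(4 * m : ℤ)) (4 * m),
        16 ^ m * ∏ i, (1 / 2 : ℝ) ^ (x i).natAbs :=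
        Finset.sum_le_sum_of_subset_of_nonneg (Finset.filter_subset _ _)
          fun x _ _ => by positivity
    _ = 16 ^ m * ∏ _i : I, ∑ k ∈ Finset.Icc (-(4 * m : ℤ)) (4 * m), (1 / 2 : ℝ) ^ k.natAbs := by
        rw [← Finset.mul_sum, Finset.prod_univ_sum]
    _ ≤ 16 ^ m * ∏ _i : I, 3 := by
        gcongr with i
        have := sum_half_pow_natAbs_le (4 * m)
        push_cast at this
        exact this.trans (by linarith [pow_pos (show (0 : ℝ) < 1 / 2 by norm_num) (4 * m)])
    _ = 48 ^ m := by
        rw [Finset.prod_const, Finset.card_univ, ← mul_pow]; norm_num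

/-- The supremum over the unit sphere of a coordinatewise affine, `2`-homogeneous function is
controlled by its values at integer vectors. -/
lemma exists_integerNet_ge (g : (I → ℝ) → ℝ)
    (hg : ∀ x i, ∃ a b : ℝ, ∀ t, g (Function.update x i t) = a + b * t)
    (hhom : ∀ (r : ℝ) x, g (fun i => r * x i) = r ^ 2 * g x) (u : I → ℝ)
    (hu : ∑ i, u i ^ 2 ≤ 1) :
    ∃ x ∈ integerNet I, Fintype.card I * g u ≤ g fun i => (x i : ℝ) := by
  set m := Fintype.card I
  -- After scaling by √m, rounding by at most 1 per coordinate changes the vector by at most √m in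
  -- norm, comparable to its own maximal length.
  obtain ⟨x, hx, hle⟩ := exists_corner_ge g hg (fun i => (⌊√m * u i⌋ : ℝ))
    (fun i => (⌊√m * u i⌋ : ℝ) + 1) (fun i => √m * u i)
    (fun i => ⟨Int.floor_le _, (Int.lt_floor_add_one _).le⟩)
  -- With y = √m u_i, use k² ≤ 2y² + 2(k − y)² and |k − y| ≤ 1. The difference of the two sides of
  -- the first inequality is (2y − k)², the square given to `nlinarith`.
  have hint : ∀ i, ∃ k : ℤ, x i = k ∧ (k : ℝ) ^ 2 ≤ 2 * (√m * u i) ^ 2 + 2 := by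
    intro i
    have h1 := Int.floor_le (√m * u i)
    have h2 := Int.lt_floor_add_one (√m * u i)
    rcases hx i with h | h
    · exact ⟨_, h, by nlinarith [sq_nonneg (2 * (√m * u i) - (⌊√m * u i⌋ : ℝ))]⟩
    · refine ⟨⌊√m * u i⌋ + 1, by rw [h]; push_cast; rfl, ?_⟩
      push_cast
      nlinarith [sq_nonneg (2 * (√m * u i) - ((⌊√m * u i⌋ : ℝ) + 1))]
  choose k hk hk2 using hint
  refine ⟨k, ?_, ?_⟩
  · rw [mem_integerNet]
    have : ((∑ i, k i ^ 2 : ℤ) : ℝ) ≤ 4 * m := by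
      push_cast
      calc ∑ i, (k i : ℝ) ^ 2 ≤ ∑ i, (2 * (√m * u i) ^ 2 + 2) := Finset.sum_le_sum fun i _ => hk2 i
        _ = 2 * m * ∑ i, u i ^ 2 + 2 * m := by
            simp_rw [mul_pow, Real.sq_sqrt (Nat.cast_nonneg m)]
            rw [Finset.sum_add_distrib, Finset.mul_sum]
            simp only [Finset.sum_const, Finset.card_univ, nsmul_eq_mul]
            rw [mul_comm (Fintype.card I : ℝ) 2]
            congr 1
            exact Finset.sum_congr rfl fun i _ => by ring
        _ ≤ 4 * m := by nlinarith [(Nat.cast_nonneg m : (0 : ℝ) ≤ m)]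
    exact_mod_cast this
  · rw [hhom, Real.sq_sqrt (Nat.cast_nonneg m)] at hle
    rwa [show (fun i => (k i : ℝ)) = x from funext fun i => (hk i).symm]

end Rounding

/-! ### Uniform bounds for the noise form -/

lemma sum_comp_update_of_mem {I : Type*} [DecidableEq I] (F : I → ℝ → ℝ) (x : I → ℝ) (i : I) (t : ℝ)
    {s : Finset I} (hi : i ∈ s) :
    ∑ j ∈ s, F j (Function.update x i t j) = F i t + ∑ j ∈ s.erase i, F j (x j) := by
  rw [← Finset.add_sum_erase s _ hi, Function.update_self]
  congr 1
  exact Finset.sum_congr rfl fun j hj => by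
    rw [Function.update_of_ne (Finset.ne_of_mem_erase hj)]

lemma sum_comp_update_of_notMem {I : Type*} [DecidableEq I] (F : I → ℝ → ℝ) (x : I → ℝ) (i : I)
    (t : ℝ) {s : Finset I} (hi : i ∉ s) :
    ∑ j ∈ s, F j (Function.update x i t j) = ∑ j ∈ s, F j (x j) :=
  Finset.sum_congr rfl fun j hj => by
    rw [Function.update_of_ne (ne_of_mem_of_not_mem hj hi)]

section NoiseForm

variable {E I J : Type*} [Fintype E] [Fintype I] [Fintype J] [DecidableEq I] [DecidableEq J]

omit [Fintype E] [Fintype I] [Fintype J] in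
lemma plantedSign_sq (σ : I × J → E) (A : Finset I) (B : Finset J) (G : Set E) (i : I) (c : J) :
    plantedSign σ A B G i c ^ 2 = 1 := by
  unfold plantedSign memSign
  split_ifs <;> norm_num

-- The entries square to 1, so the coefficient of x_i² is 1 − 1 = 0 in the part outside the planted
-- correction, and likewise inside that correction: the form has zero diagonal.
omit [Fintype E] [Fintype J] in
lemma columnForm_update (σ : I × J → E) (A : Finset I) (B : Finset J) (G : Set E) (x : I → ℝ)
    (c : J) (i : I) :
    ∃ a b : ℝ, ∀ t, columnForm σ A B G (Function.update x i t) c = a + b * t := by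
  have h1 := fun t => sum_comp_update_of_mem (fun j y => y * plantedSign σ A B G j c) x i t
    (Finset.mem_univ i)
  have h2 := fun t => sum_comp_update_of_mem (fun _ y => y ^ 2) x i t (Finset.mem_univ i)
  have hsq := plantedSign_sq σ A B G i c
  set p := plantedSign σ A B G i c
  set R := ∑ j ∈ Finset.univ.erase i, x j * plantedSign σ A B G j c
  set Q := ∑ j ∈ Finset.univ.erase i, x j ^ 2
  by_cases hc : c ∈ B
  · by_cases hi : i ∈ A
    · have h3 := fun t => sum_comp_update_of_mem (fun _ y => y) x i t hi
      have h4 := fun t => sum_comp_update_of_mem (fun _ y => y ^ 2) x i t hi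
      set U := ∑ j ∈ A.erase i, x j
      set V := ∑ j ∈ A.erase i, x j ^ 2
      refine ⟨R ^ 2 - Q - (U ^ 2 - V), 2 * p * R - 2 * U, fun t => ?_⟩
      simp only [columnForm, hc, if_true, h1, h2, h3, h4]
      linear_combination t ^ 2 * hsq
    · have h3 := fun t => sum_comp_update_of_notMem (fun _ y => y) x i t hi
      have h4 := fun t => sum_comp_update_of_notMem (fun _ y => y ^ 2) x i t hi
      set U := ∑ j ∈ A, x j
      set V := ∑ j ∈ A, x j ^ 2
      refine ⟨R ^ 2 - Q - (U ^ 2 - V), 2 * p * R, fun t => ?_⟩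
      simp only [columnForm, hc, if_true, h1, h2, h3, h4]
      linear_combination t ^ 2 * hsq
  · refine ⟨R ^ 2 - Q, 2 * p * R, fun t => ?_⟩
    simp only [columnForm, hc, if_false, h1, h2]
    linear_combination t ^ 2 * hsq

omit [Fintype E] in
lemma noiseForm_update (σ : I × J → E) (A : Finset I) (B : Finset J) (G : Set E) (x : I → ℝ)
    (i : I) :
    ∃ a b : ℝ, ∀ t, noiseForm σ A B G (Function.update x i t) = a + b * t := by
  choose a b h using fun c => columnForm_update σ A B G x c i
  refine ⟨∑ c, a c, ∑ c, b c, fun t => ?_⟩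
  simp only [noiseForm, h, Finset.sum_add_distrib, Finset.sum_mul]

omit [Fintype E] in
lemma noiseForm_smul (σ : I × J → E) (A : Finset I) (B : Finset J) (G : Set E) (r : ℝ)
    (x : I → ℝ) :
    noiseForm σ A B G (fun i => r * x i) = r ^ 2 * noiseForm σ A B G x := by
  simp only [noiseForm, Finset.mul_sum]
  refine Finset.sum_congr rfl fun c _ => ?_
  simp only [columnForm, mul_pow, mul_assoc, ← Finset.mul_sum]
  split_ifs <;> ring

omit [Fintype E] in
lemma noiseForm_eq (σ : I × J → E) (A : Finset I) (B : Finset J) (G : Set E) (x : I → ℝ) :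
    noiseForm σ A B G x = ∑ c, (∑ i, x i * plantedSign σ A B G i c) ^ 2 -
      Fintype.card J * ∑ i, x i ^ 2 - B.card * ((∑ i ∈ A, x i) ^ 2 - ∑ i ∈ A, x i ^ 2) := by
  simp only [noiseForm, columnForm, Finset.sum_sub_distrib]
  rw [← Finset.sum_filter]
  simp [mul_sub]

/-- Upper tail of the noise form, uniformly over the unit ball. -/
lemma card_noiseForm_ge_le {σ : I × J → E} (hσ : Function.Injective σ) (A : Finset I)
    (B : Finset J) (hI : 0 < Fintype.card I) {l : ℝ} (t : ℝ) (hl : 0 ≤ l) (hl' : 16 * l ≤ 1)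
    (p : Set E → Prop) [DecidablePred p]
    (hp : ∀ G, p G → ∃ u : I → ℝ, ∑ i, u i ^ 2 ≤ 1 ∧ t ≤ noiseForm σ A B G u) :
    ((Finset.univ.filter p).card : ℝ) ≤ 48 ^ Fintype.card I *
      (Real.exp (64 * l ^ 2 * (Fintype.card J + A.card * B.card) - l * t) *
        Fintype.card (Set E)) := by
  classical
  set m := Fintype.card I
  have hm : (0 : ℝ) < m := Nat.cast_pos.2 hI
  have hsub : Finset.univ.filter p ⊆ (integerNet I).biUnion fun x =>
      Finset.univ.filter fun G => m * t ≤ noiseForm σ A B G fun i => (x i : ℝ) := by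
    intro G hG
    obtain ⟨u, hu, htu⟩ := hp G (Finset.mem_filter.1 hG).2
    obtain ⟨x, hx, hle⟩ := exists_integerNet_ge (noiseForm σ A B G)
      (noiseForm_update σ A B G) (noiseForm_smul σ A B G) u hu
    rw [Finset.mem_biUnion]
    exact ⟨x, hx, Finset.mem_filter.2 ⟨Finset.mem_univ _,
      (mul_le_mul_of_nonneg_left htu hm.le).trans hle⟩⟩
  have hone : ∀ x ∈ integerNet I, ((Finset.univ.filter fun G : Set E =>
      m * t ≤ noiseForm σ A B G fun i => (x i : ℝ)).card : ℝ) ≤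
      Real.exp (64 * l ^ 2 * (Fintype.card J + A.card * B.card) - l * t) *
        Fintype.card (Set E) := by
    intro x hx
    rw [mem_integerNet] at hx
    have hx' : ∑ i, (x i : ℝ) ^ 2 ≤ 4 * m := by exact_mod_cast hx
    -- Net vectors have squared length up to s = 4m, so the tilt is divided by m: 4(l/m)s = 16l and
    -- 4(l/m)²s² = 64l², free of the dimension.
    refine card_filter_le_of_sum_exp_le (fun G => l / m * noiseForm σ A B G fun i => (x i : ℝ))
      _ _ _ (fun G hG => ?_) ?_
    · calc l * t = l / m * (m * t) := by field_simp
        _ ≤ _ := mul_le_mul_of_nonneg_left hG (by positivity)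
    · refine (sum_exp_noiseForm_le hσ A B _ (by positivity) hx' ?_).trans (le_of_eq ?_)
      · calc 4 * (l / m) * (4 * m) = 16 * l := by field_simp; ring
          _ ≤ 1 := hl'
      · congr 2
        field_simp
        ring
  calc ((Finset.univ.filter p).card : ℝ)
      ≤ ∑ x ∈ integerNet I, ((Finset.univ.filter fun G : Set E =>
        m * t ≤ noiseForm σ A B G fun i => (x i : ℝ)).card : ℝ) := by
        exact_mod_cast (Finset.card_le_card hsub).trans Finset.card_biUnion_le
    _ ≤ (integerNet I).card • _ := Finset.sum_le_card_nsmul _ _ _ hone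
    _ ≤ _ := by
        rw [nsmul_eq_mul]
        exact mul_le_mul_of_nonneg_right card_integerNet_le (by positivity)

/-- Lower tail of the noise form at a unit vector supported on the planted rows. -/
lemma card_noiseForm_le_le {σ : I × J → E} (hσ : Function.Injective σ) (A : Finset I)
    (B : Finset J) (x : I → ℝ) (hxA : ∀ i ∉ A, x i = 0) (hx : ∑ i, x i ^ 2 ≤ 1) {l : ℝ} (t : ℝ)
    (hl : 0 ≤ l) (hl' : 2 * l ≤ 1) (p : Set E → Prop) [DecidablePred p]
    (hp : ∀ G, p G → noiseForm σ A B G x ≤ -t) :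
    ((Finset.univ.filter p).card : ℝ) ≤
      Real.exp (l ^ 2 * Fintype.card J - l * t) * Fintype.card (Set E) := by
  refine card_filter_le_of_sum_exp_le (fun G => -l * noiseForm σ A B G x)
      _ _ _ (fun G hG => ?_) ?_
  · nlinarith [hp G hG]
  · refine (sum_exp_neg_columnForm_le hσ A B x hxA hl hx (by linarith) Finset.univ).trans
      (le_of_eq ?_)
    rw [Finset.card_univ]
    ring_nf

end NoiseForm

/-! ### Leading singular vectors -/

section SingularVector

variable {I J : Type} [Fintype I] [Fintype J] [DecidableEq I] [DecidableEq J]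

omit [DecidableEq J] in
lemma norm_sq_toEuclideanLin_transpose (M : Matrix I J ℝ) (x : EuclideanSpace ℝ I) :
    ‖Matrix.toEuclideanLin M.transpose x‖ ^ 2 = ∑ c, (∑ i, x i * M i c) ^ 2 := by
  rw [EuclideanSpace.real_norm_sq_eq]
  refine Finset.sum_congr rfl fun c _ => ?_
  congr 1
  simp [Matrix.toLpLin_apply, Matrix.mulVec, dotProduct, mul_comm]

/-- With y = Mᵀx, ‖y‖² = ⟨x, My⟩ ≤ ‖x‖ σ₁ ‖y‖, and ‖y‖ cancels unless it is 0. -/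
lemma norm_transpose_le_topSingularValue (M : Matrix I J ℝ) (x : EuclideanSpace ℝ I) :
    ‖Matrix.toEuclideanLin M.transpose x‖ ≤ topSingularValue M * ‖x‖ := by
  set y := Matrix.toEuclideanLin M.transpose x
  have h1 : ‖y‖ ^ 2 = inner ℝ x (Matrix.toEuclideanLin M y) := by
    rw [← real_inner_self_eq_norm_sq]
    conv_lhs => rw [show y = Matrix.toEuclideanLin M.conjTranspose x by
      rw [Matrix.conjTranspose_eq_transpose_of_trivial]]
    rw [Matrix.toEuclideanLin_conjTranspose_eq_adjoint, LinearMap.adjoint_inner_left]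
    congr 2
    rw [← Matrix.toEuclideanLin_conjTranspose_eq_adjoint,
      Matrix.conjTranspose_eq_transpose_of_trivial]
  have h2 : ‖Matrix.toEuclideanLin M y‖ ≤ topSingularValue M * ‖y‖ :=
    (Matrix.toEuclideanLin M).toContinuousLinearMap.le_opNorm y
  have h3 := (real_inner_le_norm x (Matrix.toEuclideanLin M y)).trans
    (mul_le_mul_of_nonneg_left h2 (norm_nonneg x))
  rcases (norm_nonneg y).eq_or_lt with h0 | h0
  · rw [← h0]; exact mul_nonneg (norm_nonneg _) (norm_nonneg _)
  · nlinarith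

lemma IsLeadingLeftSingularVector.norm_transpose {M : Matrix I J ℝ} {u : EuclideanSpace ℝ I}
    (h : IsLeadingLeftSingularVector M u) :
    ‖Matrix.toEuclideanLin M.transpose u‖ = topSingularValue M := by
  obtain ⟨-, v, hv, -, h2⟩ := h
  rw [h2, norm_smul, hv, mul_one]
  exact Real.norm_of_nonneg (norm_nonneg _)

/-- Maximality of a leading left singular vector among unit vectors. -/
lemma IsLeadingLeftSingularVector.sum_sq_le {M : Matrix I J ℝ} {u : EuclideanSpace ℝ I}
    (h : IsLeadingLeftSingularVector M u) (x : I → ℝ) (hx : ∑ i, x i ^ 2 = 1) :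
    ∑ c, (∑ i, x i * M i c) ^ 2 ≤ ∑ c, (∑ i, u i * M i c) ^ 2 := by
  have hn : ‖(WithLp.toLp 2 x : EuclideanSpace ℝ I)‖ = 1 := by
    rw [← sq_eq_sq₀ (norm_nonneg _) zero_le_one, EuclideanSpace.real_norm_sq_eq]
    simpa using hx
  have h1 := norm_transpose_le_topSingularValue M (WithLp.toLp 2 x)
  rw [hn, mul_one, ← h.norm_transpose] at h1
  have h2 := pow_le_pow_left₀ (norm_nonneg _) h1 2
  rwa [norm_sq_toEuclideanLin_transpose, norm_sq_toEuclideanLin_transpose] at h2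

omit [DecidableEq I] in
lemma sinTheta_nonneg (u v : EuclideanSpace ℝ I) : 0 ≤ sinTheta u v :=
  Real.sin_nonneg_of_nonneg_of_le_pi (Real.arccos_nonneg _) (Real.arccos_le_pi _)

omit [DecidableEq I] in
lemma sinTheta_sq (u v : EuclideanSpace ℝ I) :
    sinTheta u v ^ 2 = 1 - (|inner ℝ u v| / (‖u‖ * ‖v‖)) ^ 2 := by
  rw [sinTheta, principalAngle, Real.sin_arccos, Real.sq_sqrt]
  have h := abs_real_inner_div_norm_mul_norm_le_one u v
  rw [abs_div, abs_mul, abs_norm, abs_norm] at h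
  have h0 : 0 ≤ |inner ℝ u v| / (‖u‖ * ‖v‖) := by positivity
  nlinarith

/-- The unit vector proportional to the indicator of `A`. -/
noncomputable def unitIndicator (A : Finset I) (i : I) : ℝ := if i ∈ A then (√A.card)⁻¹ else 0

lemma sum_unitIndicator_sq {A : Finset I} (hA : 0 < A.card) : ∑ i, unitIndicator A i ^ 2 = 1 := by
  have : (0 : ℝ) < A.card := Nat.cast_pos.2 hA
  simp only [unitIndicator, ite_pow, inv_pow, Real.sq_sqrt (Nat.cast_nonneg A.card)]
  simp [this.ne']

/-- Deterministic perturbation bound for the leading left singular vector of a sign matrix with a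
planted block. -/
lemma sinTheta_sq_le {E : Type*} (σ : I × J → E) (A : Finset I) (B : Finset J) (G : Set E)
    (hA : 0 < A.card) (hB : 0 < B.card) {M : Matrix I J ℝ}
    (hM : ∀ i c, M i c = plantedSign σ A B G i c) {u : EuclideanSpace ℝ I}
    (hu : IsLeadingLeftSingularVector M u) :
    sinTheta u (WithLp.toLp 2 fun i => if i ∈ A then 1 else 0) ^ 2 ≤ 1 / A.card +
      (noiseForm σ A B G u - noiseForm σ A B G (unitIndicator A)) / (A.card * B.card) := by
  have hA' : (0 : ℝ) < A.card := Nat.cast_pos.2 hA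
  have hB' : (0 : ℝ) < B.card := Nat.cast_pos.2 hB
  have hnorm : ‖(WithLp.toLp 2 fun i => if i ∈ A then 1 else 0 : EuclideanSpace ℝ I)‖ ^ 2 =
      A.card := by
    rw [EuclideanSpace.real_norm_sq_eq]
    simp
  have hinner : inner ℝ u (WithLp.toLp 2 fun i => if i ∈ A then 1 else 0 : EuclideanSpace ℝ I) =
      ∑ i ∈ A, u i := by
    rw [PiLp.inner_apply]
    simp
  rw [sinTheta_sq, hu.1, one_mul, div_pow, sq_abs, hinner, hnorm]
  have hmax := hu.sum_sq_le (unitIndicator A) (sum_unitIndicator_sq hA)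
  simp only [hM] at hmax
  have hu1 : ∑ i, u i ^ 2 = 1 := by rw [← EuclideanSpace.real_norm_sq_eq, hu.1, one_pow]
  have e1 := noiseForm_eq σ A B G u
  have e2 := noiseForm_eq σ A B G (unitIndicator A)
  have s1 : ∑ i ∈ A, unitIndicator A i = A.card * (√A.card)⁻¹ := by
    rw [Finset.sum_congr rfl fun i hi => show unitIndicator A i = (√A.card)⁻¹ by
      simp [unitIndicator, hi]]
    simp
  have s2 : ∑ i ∈ A, unitIndicator A i ^ 2 = 1 := by
    rw [← sum_unitIndicator_sq hA]
    exact Finset.sum_subset (Finset.subset_univ _) fun i _ hi => by simp [unitIndicator, hi]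
  have s3 : (A.card * (√A.card)⁻¹ : ℝ) ^ 2 = A.card := by
    rw [mul_pow, inv_pow, Real.sq_sqrt hA'.le]; field_simp
  rw [sum_unitIndicator_sq hA, s1, s2, s3] at e2
  rw [hu1] at e1
  have hpos : 0 ≤ ∑ i ∈ A, u i ^ 2 := Finset.sum_nonneg fun i _ => sq_nonneg _
  set P := ∑ i ∈ A, u i
  -- Subtract the two noise identities, use maximality of u, and drop the nonnegative |B| ∑_A u_i².
  -- The extra |B| comes from the diagonal correction at the indicator and becomes the 1/|A| of the
  -- bound.
  have hfin : A.card * B.card - B.card * P ^ 2 ≤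
      B.card + (noiseForm σ A B G u - noiseForm σ A B G (unitIndicator A)) := by
    nlinarith [mul_nonneg hB'.le hpos]
  calc 1 - P ^ 2 / A.card = (A.card * B.card - B.card * P ^ 2) / (A.card * B.card) := by
        field_simp
    _ ≤ (B.card + (noiseForm σ A B G u - noiseForm σ A B G (unitIndicator A))) /
        (A.card * B.card) := by gcongr
    _ = _ := by rw [add_div]; congr 1; field_simp

end SingularVector

/-! ### The matricized adjacency tensor -/

lemma eq_of_mem_block {N : ℕ} {i : Fin N} {k l : Fin 3} (hk : i ∈ block N k) (hl : i ∈ block N l) :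
    k = l := by
  simp only [block, Finset.mem_filter, Finset.mem_univ, true_and] at hk hl
  by_contra h
  wlog hlt : k.val < l.val generalizing k l
  · exact this hl hk (Ne.symm h) (by omega)
  have : (k.val + 1) * N / 6 ≤ l.val * N / 6 :=
    Nat.div_le_div_right (Nat.mul_le_mul_right N hlt)
  omega

/-- The triple formed by one vertex of each block. -/
def blockTriple {N : ℕ} (t : ∀ m : Fin 3, block N m) : Triple N :=
  ⟨{(t 0 : Fin N), (t 1 : Fin N), (t 2 : Fin N)}, by
    have h : ∀ a b : Fin 3, a ≠ b → (t a : Fin N) ≠ t b := fun a b hab he =>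
      hab (eq_of_mem_block (t a).2 (he ▸ (t b).2))
    rw [Finset.card_eq_three]
    exact ⟨_, _, _, h 0 1 (by decide), h 0 2 (by decide), h 1 2 (by decide), rfl⟩⟩

lemma mem_blockTriple {N : ℕ} (t : ∀ m : Fin 3, block N m) (i : Fin N) :
    i ∈ (blockTriple t).val ↔ ∃ m, i = t m := by
  simp [blockTriple, Fin.exists_fin_succ]

/-- Disjointness of the blocks lets the ordered entry be recovered from the unordered triple. This
is what makes the matrix entries independent. -/
lemma blockTriple_injective (N : ℕ) : Function.Injective (blockTriple (N := N)) := by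
  intro t t' h
  funext m
  have h1 : (t m : Fin N) ∈ (blockTriple t').val := h ▸ (mem_blockTriple t _).2 ⟨m, rfl⟩
  obtain ⟨m', hm'⟩ := (mem_blockTriple t' _).1 h1
  have : m = m' := eq_of_mem_block (t m).2 (hm' ▸ (t' m').2)
  subst this
  exact Subtype.ext hm'

/-- The triple underlying an entry of the mode-`k` matricization. -/
def entryTriple (N : ℕ) (k : Fin 3)
    (p : block N k × ∀ m : {m : Fin 3 // m ≠ k}, block N m) : Triple N :=
  blockTriple ((Equiv.piSplitAt k fun m => block N m).symm p)

lemma entryTriple_injective (N : ℕ) (k : Fin 3) : Function.Injective (entryTriple N k) :=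
  (blockTriple_injective N).comp (Equiv.injective _)

/-- The rows of the mode-`k` matricization that belong to `C`. -/
def cliqueRows {N : ℕ} (C : Finset (Fin N)) (k : Fin 3) : Finset (block N k) :=
  Finset.univ.filter fun i => (i : Fin N) ∈ C

/-- The columns of the mode-`k` matricization that belong to `C`. -/
def cliqueColumns {N : ℕ} (C : Finset (Fin N)) (k : Fin 3) :
    Finset (∀ m : {m : Fin 3 // m ≠ k}, block N m) :=
  Fintype.piFinset fun m => cliqueRows C m

lemma blockTriple_subset {N : ℕ} (t : ∀ m : Fin 3, block N m) (C : Finset (Fin N)) :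
    (blockTriple t).val ⊆ C ↔ ∀ m, (t m : Fin N) ∈ C := by
  constructor
  · exact fun h m => h ((mem_blockTriple t _).2 ⟨m, rfl⟩)
  · intro h i hi
    obtain ⟨m, rfl⟩ := (mem_blockTriple t i).1 hi
    exact h m

lemma signMatrix_plant {N : ℕ} (k : Fin 3) (G : Hypergraph3 N) (C : Finset (Fin N))
    (i : block N k) (c : ∀ m : {m : Fin 3 // m ≠ k}, block N m) :
    signMatrix k (plant G C) i c =
      plantedSign (entryTriple N k) (cliqueRows C k) (cliqueColumns C k) G i c := by
  set t := (Equiv.piSplitAt k fun m => block N m).symm (i, c) with ht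
  have hC : (i ∈ cliqueRows C k ∧ c ∈ cliqueColumns C k) ↔ (blockTriple t).val ⊆ C := by
    have hk : t k = i := by simp [ht, Equiv.piSplitAt]
    have hm : ∀ m : {m : Fin 3 // m ≠ k}, t m = c m := fun m => by
      simp [ht, Equiv.piSplitAt, m.2]
    rw [blockTriple_subset]
    simp only [cliqueRows, cliqueColumns, Fintype.mem_piFinset, Finset.mem_filter,
      Finset.mem_univ, true_and]
    constructor
    · rintro ⟨h1, h2⟩ m
      by_cases hmk : m = k
      · subst hmk; rwa [hk]
      · rw [hm ⟨m, hmk⟩]; exact h2 ⟨m, hmk⟩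
    · exact fun h => ⟨hk ▸ h k, fun m => hm m ▸ h m⟩
  have hmem : (∃ e ∈ plant G C, e.val = {(t 0 : Fin N), (t 1 : Fin N), (t 2 : Fin N)}) ↔
      blockTriple t ∈ G ∨ (blockTriple t).val ⊆ C := by
    constructor
    · rintro ⟨e, he, heq⟩
      have : e = blockTriple t := Subtype.ext heq
      subst this
      exact he
    · exact fun h => ⟨_, h, rfl⟩
  have hval : signMatrix k (plant G C) i c =
      2 * adjacencyTensor (plant G C) (fun m => (t m : Fin N)) - 1 := rfl
  rw [hval, adjacencyTensor, plantedSign, memSign, entryTriple, ← ht]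
  by_cases h1 : (blockTriple t).val ⊆ C
  · rw [if_pos (hC.2 h1), if_pos (hmem.2 (.inr h1))]; norm_num
  · rw [if_neg (mt hC.1 h1)]
    by_cases h2 : blockTriple t ∈ G
    · rw [if_pos (hmem.2 (.inl h2)), if_pos h2]; norm_num
    · rw [if_neg (fun h => (hmem.1 h).elim h2 h1), if_neg h2]; norm_num

/-- The size |A||B| of the planted block is the same for all three modes, so one balance condition
on C serves every k. -/
lemma card_cliqueRows_mul_card_cliqueColumns {N : ℕ} (C : Finset (Fin N)) (k : Fin 3) :
    (cliqueRows C k).card * (cliqueColumns C k).card = ∏ m, (cliqueRows C m).card := by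
  rw [cliqueColumns, Fintype.card_piFinset,
    ← Fintype.prod_subtype_mul_prod_subtype (fun m => m = k) fun m => (cliqueRows C m).card]
  congr 1
  convert (Fintype.prod_subsingleton (fun m : {m : Fin 3 // m = k} => (cliqueRows C m).card)
    ⟨k, rfl⟩).symm

lemma card_cliqueRows {N : ℕ} (C : Finset (Fin N)) (k : Fin 3) :
    (cliqueRows C k).card = (block N k ∩ C).card := by
  rw [cliqueRows, ← Finset.card_map (Function.Embedding.subtype _)]
  congr 1
  ext i
  simp [and_comm]

lemma card_block_le (N : ℕ) (k : Fin 3) : Fintype.card (block N k) ≤ N := by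
  simpa using Finset.card_le_univ (block N k)

lemma card_columns_le (N : ℕ) (k : Fin 3) :
    Fintype.card (∀ m : {m : Fin 3 // m ≠ k}, block N m) ≤ N ^ 2 := by
  rw [Fintype.card_pi]
  refine (Finset.prod_le_pow_card _ _ N fun m _ => card_block_le N m.1).trans (le_of_eq ?_)
  congr 1
  simp

/-! ### Concentration of the size of the intersection with a random subset -/

section Hypergeometric

variable {α : Type*} [DecidableEq α]

lemma sum_card_inter (D : Finset α) (P : Finset (Finset α)) :
    ∑ C ∈ P, ((D ∩ C).card : ℝ) = ∑ i ∈ D, ((P.filter fun C => {i} ⊆ C).card : ℝ) := by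
  simp only [← Finset.filter_mem_eq_inter, Finset.card_filter, Finset.singleton_subset_iff]
  push_cast
  exact Finset.sum_comm

lemma sum_card_inter_sq (D : Finset α) (P : Finset (Finset α)) :
    ∑ C ∈ P, ((D ∩ C).card : ℝ) ^ 2 =
      ∑ i ∈ D, ∑ j ∈ D, ((P.filter fun C => {i, j} ⊆ C).card : ℝ) := by
  have h : ∀ C : Finset α, ((D ∩ C).card : ℝ) ^ 2 =
      ∑ i ∈ D, ∑ j ∈ D, if {i, j} ⊆ C then (1 : ℝ) else 0 := by
    intro C
    rw [← Finset.filter_mem_eq_inter, Finset.card_filter, sq]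
    push_cast
    rw [Finset.sum_mul_sum]
    refine Finset.sum_congr rfl fun i _ => Finset.sum_congr rfl fun j _ => ?_
    by_cases hi : i ∈ C <;> by_cases hj : j ∈ C <;> simp [Finset.insert_subset_iff, hi, hj]
  simp only [h, Finset.card_filter]
  push_cast
  rw [Finset.sum_comm]
  exact Finset.sum_congr rfl fun i _ => Finset.sum_comm

lemma card_mul_card_filter_singleton {V : Finset α} {κ : ℕ} (hκ : 1 ≤ κ) {i : α} (hi : i ∈ V) :
    (V.card : ℝ) * ((V.powersetCard κ).filter fun C => {i} ⊆ C).card =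
      κ * (V.powersetCard κ).card := by
  rw [Finset.card_filter_powersetCard_subset _ _ _ (by simpa using hi) (by simpa using hκ),
    Finset.card_powersetCard, Finset.card_singleton]
  obtain ⟨k, rfl⟩ := Nat.exists_eq_add_of_le' hκ
  obtain ⟨n, hn⟩ := Nat.exists_eq_add_of_le' (Finset.card_pos.2 ⟨i, hi⟩)
  rw [hn, Nat.add_sub_cancel, Nat.add_sub_cancel]
  have := Nat.add_one_mul_choose_eq n k
  rw [mul_comm ((n + 1).choose (k + 1))] at this
  exact_mod_cast this

lemma card_mul_card_filter_pair {V : Finset α} {κ : ℕ} (hκ : 2 ≤ κ) {i j : α} (hi : i ∈ V)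
    (hj : j ∈ V) (hij : i ≠ j) :
    (V.card : ℝ) * (V.card - 1) * ((V.powersetCard κ).filter fun C => {i, j} ⊆ C).card =
      κ * (κ - 1) * (V.powersetCard κ).card := by
  have hsub : {i, j} ⊆ V := by simp [Finset.insert_subset_iff, hi, hj]
  have hV := Finset.card_le_card hsub
  rw [Finset.card_filter_powersetCard_subset _ _ _ hsub (by rwa [Finset.card_pair hij]),
    Finset.card_powersetCard]
  rw [Finset.card_pair hij] at hV ⊢
  obtain ⟨k, rfl⟩ := Nat.exists_eq_add_of_le' hκ
  obtain ⟨n, hn⟩ := Nat.exists_eq_add_of_le' hV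
  rw [hn, Nat.add_sub_cancel, Nat.add_sub_cancel]
  have h1 : ((n : ℝ) + 1) * n.choose k = (n + 1).choose (k + 1) * (k + 1) := by
    exact_mod_cast Nat.add_one_mul_choose_eq n k
  have h2 : ((n : ℝ) + 2) * (n + 1).choose (k + 1) = (n + 2).choose (k + 2) * (k + 2) := by
    exact_mod_cast Nat.add_one_mul_choose_eq (n + 1) (k + 1)
  push_cast
  linear_combination ((n : ℝ) + 2) * h1 + ((k : ℝ) + 1) * h2

/-- The variance of the hypergeometric distribution is at most its mean. -/
lemma sum_card_inter_sub_sq_le {V D : Finset α} (hD : D ⊆ V) {κ : ℕ} (hκ : 2 ≤ κ)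
    (hV : κ ≤ V.card) :
    ∑ C ∈ V.powersetCard κ, ((D ∩ C).card - (κ * D.card / V.card : ℝ)) ^ 2 ≤
      κ * D.card / V.card * (V.powersetCard κ).card := by
  obtain ⟨n, hn⟩ : ∃ n : ℝ, n = V.card := ⟨_, rfl⟩
  obtain ⟨d, hd⟩ : ∃ d : ℝ, d = D.card := ⟨_, rfl⟩
  obtain ⟨k, hk⟩ : ∃ k : ℝ, k = κ := ⟨_, rfl⟩
  obtain ⟨p, hp⟩ : ∃ p : ℝ, p = (V.powersetCard κ).card := ⟨_, rfl⟩
  have hk2 : 2 ≤ k := by rw [hk]; exact_mod_cast hκ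
  have hkn : k ≤ n := by rw [hk, hn]; exact_mod_cast hV
  have hdn : d ≤ n := by rw [hd, hn]; exact_mod_cast Finset.card_le_card hD
  have hd0 : 0 ≤ d := hd ▸ Nat.cast_nonneg _
  have hp0 : 0 ≤ p := hp ▸ Nat.cast_nonneg _
  have hn0 : 0 < n := by linarith
  have hn1 : 0 < n - 1 := by linarith
  have e1 : ∑ C ∈ V.powersetCard κ, ((D ∩ C).card : ℝ) = d * (k * p / n) := by
    rw [sum_card_inter, Finset.sum_congr rfl fun i hi =>
      show _ = k * p / n by
        rw [eq_div_iff hn0.ne', hk, hp, hn, mul_comm,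
          card_mul_card_filter_singleton (by omega) (hD hi)]]
    simp [hd]
  have e2 : ∑ C ∈ V.powersetCard κ, ((D ∩ C).card : ℝ) ^ 2 =
      d * (k * p / n) + d * (d - 1) * (k * (k - 1) * p / (n * (n - 1))) := by
    have : ∀ i ∈ D, ∑ j ∈ D, (((V.powersetCard κ).filter fun C => {i, j} ⊆ C).card : ℝ) =
        k * p / n + (d - 1) * (k * (k - 1) * p / (n * (n - 1))) := by
      intro i hi
      rw [← Finset.add_sum_erase _ _ hi]
      congr 1
      · rw [eq_div_iff hn0.ne', hk, hp, hn, mul_comm, Finset.pair_eq_singleton,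
          card_mul_card_filter_singleton (by omega) (hD hi)]
      · rw [Finset.sum_congr rfl fun j hj =>
          show _ = k * (k - 1) * p / (n * (n - 1)) by
            rw [eq_div_iff (by positivity), hk, hp, hn, mul_comm,
              card_mul_card_filter_pair hκ (hD hi) (hD (Finset.mem_of_mem_erase hj))
                (Finset.ne_of_mem_erase hj).symm]]
        rw [Finset.sum_const, Finset.card_erase_of_mem hi, nsmul_eq_mul,
          Nat.cast_sub (Finset.card_pos.2 ⟨i, hi⟩), hd, Nat.cast_one]
    rw [sum_card_inter_sq, Finset.sum_congr rfl this, Finset.sum_const, nsmul_eq_mul, hd]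
    ring
  have hexp : ∑ C ∈ V.powersetCard κ, ((D ∩ C).card - (k * d / n : ℝ)) ^ 2 =
      ∑ C ∈ V.powersetCard κ, ((D ∩ C).card : ℝ) ^ 2 -
        2 * (k * d / n) * ∑ C ∈ V.powersetCard κ, ((D ∩ C).card : ℝ) + (k * d / n) ^ 2 * p := by
    simp only [sub_sq, Finset.sum_add_distrib, Finset.sum_sub_distrib, Finset.sum_const,
      nsmul_eq_mul, Finset.mul_sum, hp]
    rw [mul_comm _ ((k * d / n) ^ 2)]
    congr 2
    exact Finset.sum_congr rfl fun C _ => by ring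
  rw [← hn, ← hd, ← hk, ← hp, hexp, e1, e2]
  -- Negative correlation of sampling without replacement: the off-diagonal part of the second
  -- moment is at most the squared mean, leaving only the diagonal part, which is the mean.
  have hkey : (d - 1) * (k - 1) / (n - 1) ≤ d * k / n := by
    rw [div_le_div_iff₀ hn1 hn0]
    nlinarith [mul_nonneg hd0 (sub_nonneg.2 hkn), mul_nonneg hd0 (sub_nonneg.2 hdn),
      mul_nonneg (sub_nonneg.2 hdn) (by linarith : (0 : ℝ) ≤ k)]
  have hfac : 0 ≤ d * k * p / n := by positivity
  have h3 := mul_le_mul_of_nonneg_left hkey hfac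
  have e3 : d * (d - 1) * (k * (k - 1) * p / (n * (n - 1))) =
      d * k * p / n * ((d - 1) * (k - 1) / (n - 1)) := by field_simp
  rw [e3]
  have e4 : 2 * (k * d / n) * (d * (k * p / n)) = 2 * (d * k * p / n * (d * k / n)) := by ring
  have e5 : (k * d / n) ^ 2 * p = d * k * p / n * (d * k / n) := by ring
  have e6 : d * (k * p / n) = k * d / n * p := by ring
  rw [e4, e5, e6]
  linarith

/-- Chebyshev's inequality for the lower tail of the hypergeometric distribution. -/
lemma card_filter_card_inter_le {V D : Finset α} (hD : D ⊆ V) {κ : ℕ} (hκ : 2 ≤ κ)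
    (hV : κ ≤ V.card) {r : ℝ} (hr : 0 < r) (hr' : 2 * r * V.card ≤ κ * D.card) :
    (((V.powersetCard κ).filter fun C => ((D ∩ C).card : ℝ) ≤ r).card : ℝ) ≤
      2 / r * (V.powersetCard κ).card := by
  have hn : (0 : ℝ) < V.card := Nat.cast_pos.2 (by omega)
  set μ : ℝ := κ * D.card / V.card
  have hμ : 2 * r ≤ μ := by rwa [le_div_iff₀ hn]
  -- Since r ≤ μ/2, the event forces a deviation of at least μ/2, giving probability at most 4/μ ≤
  -- 2/r.
  have h1 : (((V.powersetCard κ).filter fun C => ((D ∩ C).card : ℝ) ≤ r).card : ℝ) *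
      (μ / 2) ^ 2 ≤ μ * (V.powersetCard κ).card := by
    refine le_trans ?_ (sum_card_inter_sub_sq_le hD hκ hV)
    rw [← nsmul_eq_mul]
    refine (Finset.card_nsmul_le_sum _ (fun C => ((D ∩ C).card - μ : ℝ) ^ 2) _
      fun C hC => ?_).trans (Finset.sum_le_sum_of_subset_of_nonneg (Finset.filter_subset _ _)
        fun _ _ _ => sq_nonneg _)
    have := (Finset.mem_filter.1 hC).2
    nlinarith
  have h2 : (((V.powersetCard κ).filter fun C => ((D ∩ C).card : ℝ) ≤ r).card : ℝ) * μ ≤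
      4 * (V.powersetCard κ).card := by
    have hμ0 : 0 < μ := by linarith
    refine le_of_mul_le_mul_left ?_ hμ0
    linarith
  rw [div_mul_eq_mul_div, le_div_iff₀ hr]
  have h3 : (0 : ℝ) ≤ ((V.powersetCard κ).filter fun C => ((D ∩ C).card : ℝ) ≤ r).card :=
    Nat.cast_nonneg _
  nlinarith

end Hypergeometric

/-! ### Sizes of the vertex blocks -/

lemma card_firstHalf (N : ℕ) : (firstHalf N).card = N / 2 := by
  rw [firstHalf, Fin.card_filter_val_lt]
  omega

lemma card_block (N : ℕ) (k : Fin 3) :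
    (block N k).card = (k.val + 1) * N / 6 - k.val * N / 6 := by
  have hk : (k.val + 1) * N / 6 ≤ N := by
    have : k.val + 1 ≤ 3 := k.2
    have := Nat.mul_le_mul_right N this
    omega
  rw [← Nat.card_Ico, ← Finset.card_map Fin.valEmbedding]
  congr 1
  ext i
  simp only [block, Finset.mem_map, Finset.mem_filter, Finset.mem_univ, true_and,
    Fin.valEmbedding_apply, Finset.mem_Ico]
  constructor
  · rintro ⟨a, h, rfl⟩; exact h
  · exact fun h => ⟨⟨i, h.2.trans_le hk⟩, h, rfl⟩

lemma block_subset_firstHalf (N : ℕ) (k : Fin 3) : block N k ⊆ firstHalf N := by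
  intro i hi
  simp only [block, firstHalf, Finset.mem_filter, Finset.mem_univ, true_and] at hi ⊢
  have : k.val + 1 ≤ 3 := k.2
  have := Nat.mul_le_mul_right N this
  omega

lemma le_twelve_mul_card_block {N : ℕ} (hN : 12 ≤ N) (k : Fin 3) : N ≤ 12 * (block N k).card := by
  have e : (k.val + 1) * N = k.val * N + N := by ring
  rw [card_block, e]
  omega

/-! ### The two laws of the model -/

lemma erdosRenyi_real_apply (N : ℕ) (S : Set (Hypergraph3 N)) [DecidablePred (· ∈ S)] :
    (erdosRenyi N).real S * Fintype.card (Hypergraph3 N) =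
      (Finset.univ.filter (· ∈ S)).card := by
  have h1 : ∀ G : Hypergraph3 N, (erdosRenyi N).real {G} = (1 / 2) ^ Fintype.card (Triple N) := by
    intro G
    rw [erdosRenyi, setBernoulli_real_singleton _ (Set.subset_univ G) Set.finite_univ]
    have h2 : (Set.univ : Set (Triple N)).ncard = Fintype.card (Triple N) := by
      rw [Set.ncard_univ, Nat.card_eq_fintype_card]
    have h3 := Set.ncard_sdiff_add_ncard_of_subset (Set.subset_univ G)
    rw [← h2, ← h3, pow_add]
    norm_num
    ring
  have hS : S = ((Finset.univ.filter (· ∈ S) : Finset (Hypergraph3 N)) : Set (Hypergraph3 N)) := by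
    simp
  conv_lhs => rw [hS]
  rw [← sum_measureReal_singleton, Finset.sum_congr rfl fun G _ => h1 G, Finset.sum_const,
    nsmul_eq_mul, mul_assoc, Fintype.card_set]
  push_cast
  rw [← mul_pow]
  norm_num

lemma cliqueLaw_real_apply {N : ℕ} (κ : ℕ) (V : Finset (Fin N)) (h : κ ≤ V.card)
    (S : Set (Finset (Fin N))) [DecidablePred (· ∈ S)] :
    (cliqueLaw κ V h).real S =
      ((V.powersetCard κ).filter (· ∈ S)).card / (V.powersetCard κ).card := by
  rw [measureReal_def, cliqueLaw, PMF.toMeasure_uniformOfFinset_apply _ _ (.of_discrete)]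
  rw [ENNReal.toReal_div, ENNReal.toReal_natCast, ENNReal.toReal_natCast]
  congr!

/-- A set has all the intersection sizes that a typical `κ`-subset of `V₁` has. -/
def IsBalanced {N : ℕ} (κ : ℕ) (C : Finset (Fin N)) : Prop :=
  C.card = κ ∧ ∀ m : Fin 3, (κ : ℝ) < 12 * (block N m ∩ C).card

/-- A block has at least N/12 vertices and V₁ at most N/2, so the mean intersection is at least κ/6.
The threshold κ/12 is half of this, and each of the three blocks fails with probability at most
2/(κ/12) = 24/κ. -/
lemma cliqueLaw_not_isBalanced_le {N κ : ℕ} (hN : 12 ≤ N) (hκ : 2 ≤ κ)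
    (h : κ ≤ (firstHalf N).card) :
    (cliqueLaw κ (firstHalf N) h).real {C | ¬ IsBalanced κ C} ≤ 72 / κ := by
  classical
  have hP : (0 : ℝ) < ((firstHalf N).powersetCard κ).card :=
    Nat.cast_pos.2 (Finset.card_pos.2 (Finset.powersetCard_nonempty.2 h))
  have hκ0 : (0 : ℝ) < κ := Nat.cast_pos.2 (by omega)
  rw [cliqueLaw_real_apply, div_le_iff₀ hP]
  have hsub : ((firstHalf N).powersetCard κ).filter (· ∈ {C | ¬ IsBalanced κ C}) ⊆
      Finset.univ.biUnion fun m : Fin 3 => ((firstHalf N).powersetCard κ).filter fun C =>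
        ((block N m ∩ C).card : ℝ) ≤ κ / 12 := by
    intro C hC
    obtain ⟨h1, h2⟩ := Finset.mem_filter.1 hC
    simp only [IsBalanced, Set.mem_ofPred_eq, not_and, not_forall, not_lt] at h2
    obtain ⟨m, hm⟩ := h2 (Finset.mem_powersetCard.1 h1).2
    exact Finset.mem_biUnion.2 ⟨m, Finset.mem_univ _, Finset.mem_filter.2 ⟨h1, by linarith⟩⟩
  have hone : ∀ m ∈ (Finset.univ : Finset (Fin 3)),
      ((((firstHalf N).powersetCard κ).filter fun C =>
        ((block N m ∩ C).card : ℝ) ≤ κ / 12).card : ℝ) ≤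
        2 / (κ / 12) * ((firstHalf N).powersetCard κ).card := by
    intro m _
    refine card_filter_card_inter_le (block_subset_firstHalf N m) hκ h (by positivity) ?_
    have h1 : (N : ℝ) ≤ 12 * (block N m).card := by exact_mod_cast le_twelve_mul_card_block hN m
    have h2 : 2 * ((firstHalf N).card : ℝ) ≤ N := by
      rw [card_firstHalf]
      exact_mod_cast Nat.mul_div_le N 2
    nlinarith
  calc ((((firstHalf N).powersetCard κ).filter (· ∈ {C | ¬ IsBalanced κ C})).card : ℝ)
      ≤ ∑ m : Fin 3, ((((firstHalf N).powersetCard κ).filter fun C =>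
        ((block N m ∩ C).card : ℝ) ≤ κ / 12).card : ℝ) := by
        exact_mod_cast (Finset.card_le_card hsub).trans Finset.card_biUnion_le
    _ ≤ (Finset.univ : Finset (Fin 3)).card • _ := Finset.sum_le_card_nsmul _ _ _ hone
    _ = _ := by
        simp only [Finset.card_univ, Fintype.card_fin, nsmul_eq_mul]
        field_simp
        norm_num

/-! ### The angle for a balanced clique -/

lemma IsBalanced.lt_card_cliqueRows {N κ : ℕ} {C : Finset (Fin N)} (h : IsBalanced κ C)
    (m : Fin 3) : (κ : ℝ) < 12 * (cliqueRows C m).card := by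
  rw [card_cliqueRows]; exact h.2 m

lemma IsBalanced.pow_three_le {N κ : ℕ} {C : Finset (Fin N)} (h : IsBalanced κ C) (k : Fin 3) :
    (κ : ℝ) ^ 3 ≤ 1728 * ((cliqueRows C k).card * (cliqueColumns C k).card) := by
  have h1 : ((cliqueRows C k).card * (cliqueColumns C k).card : ℝ) =
      ∏ m, ((cliqueRows C m).card : ℝ) := by
    exact_mod_cast card_cliqueRows_mul_card_cliqueColumns C k
  have h2 : ∏ _m : Fin 3, (κ / 12 : ℝ) ≤ ∏ m, ((cliqueRows C m).card : ℝ) :=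
    Finset.prod_le_prod (fun _ _ => by positivity) fun m _ => by
      linarith [h.lt_card_cliqueRows m]
  rw [Finset.prod_const, Finset.card_univ, Fintype.card_fin] at h2
  rw [h1]
  nlinarith

lemma IsBalanced.le_pow_three {N κ : ℕ} {C : Finset (Fin N)} (h : IsBalanced κ C) (k : Fin 3) :
    ((cliqueRows C k).card * (cliqueColumns C k).card : ℝ) ≤ (κ : ℝ) ^ 3 := by
  have h1 : (cliqueRows C k).card * (cliqueColumns C k).card ≤ κ ^ 3 := by
    rw [card_cliqueRows_mul_card_cliqueColumns]
    refine (Finset.prod_le_pow_card _ _ κ fun m _ => ?_).trans (by simp)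
    rw [card_cliqueRows, ← h.1]
    exact Finset.card_le_card Finset.inter_subset_right
  exact_mod_cast h1

lemma cliqueIndicator_eq {N : ℕ} (C : Finset (Fin N)) (k : Fin 3) :
    cliqueIndicator C (block N k) =
      WithLp.toLp 2 fun i => if i ∈ cliqueRows C k then 1 else 0 := by
  simp [cliqueIndicator, cliqueRows]

lemma IsBalanced.erdosRenyi_le_sinTheta_le {N κ : ℕ} {C : Finset (Fin N)} (hC : IsBalanced κ C)
    (hκ : 0 < κ) (k : Fin 3) {u : Hypergraph3 N → EuclideanSpace ℝ (block N k)}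
    (hu : ∀ G, IsLeadingLeftSingularVector (signMatrix k G) (u G)) {ε : ℝ} (hε : 0 < ε)
    (hκε : 24 ≤ ε ^ 2 * κ) {l : ℝ} (hl : 0 ≤ l) (hl' : 16 * l ≤ 1) :
    (erdosRenyi N).real
        {G | ε ≤ sinTheta (u (plant G C)) (cliqueIndicator C (block N k))} ≤
      2 * (48 ^ N * Real.exp
        (64 * l ^ 2 * (N ^ 2 + κ ^ 3) - l * (ε ^ 2 / 6912 * κ ^ 3))) := by
  classical
  set A := cliqueRows C k
  set B := cliqueColumns C k
  set σ := entryTriple N k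
  set t : ℝ := ε ^ 2 / 6912 * κ ^ 3
  have hσ : Function.Injective σ := entryTriple_injective N k
  have hκ0 : (0 : ℝ) < κ := Nat.cast_pos.2 hκ
  have hA12 : (κ : ℝ) < 12 * A.card := hC.lt_card_cliqueRows k
  have hAR : (0 : ℝ) < A.card := by linarith
  have hA : 0 < A.card := Nat.cast_pos.1 hAR
  have hAB := hC.pow_three_le k
  have hAB' := hC.le_pow_three k
  change (κ : ℝ) ^ 3 ≤ 1728 * (A.card * B.card) at hAB
  change (A.card * B.card : ℝ) ≤ _ at hAB'
  have hABpos : (0 : ℝ) < A.card * B.card := by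
    have : (0 : ℝ) < (κ : ℝ) ^ 3 := by positivity
    linarith
  have hB : 0 < B.card := Nat.cast_pos.1 (pos_of_mul_pos_right hABpos hAR.le)
  have hI : 0 < Fintype.card (block N k) := Fintype.card_pos_iff.2 ⟨(Finset.card_pos.1 hA).choose⟩
  have hJ : (Fintype.card (∀ m : {m : Fin 3 // m ≠ k}, block N m) : ℝ) ≤ N ^ 2 := by
    exact_mod_cast card_columns_le N k
  set S := {G : Hypergraph3 N | ε ≤ sinTheta (u (plant G C)) (cliqueIndicator C (block N k))}
  -- Half of ε² absorbs 1/|A| < 12/κ, which is the role of `hκε`. The other half forces a noise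
  -- difference of at least (ε²/2)|A||B| ≥ ε²κ³/3456 = 2t, so one of the two noise terms exceeds t
  -- in absolute value with the relevant sign; here 6912 = 4 · 12³.
  have hsplit : ∀ G ∈ S, t ≤ noiseForm σ A B G (u (plant G C)) ∨
      noiseForm σ A B G (unitIndicator A) ≤ -t := by
    intro G hG
    have h1 := sinTheta_sq_le σ A B G hA hB (signMatrix_plant k G C) (hu (plant G C))
    rw [← cliqueIndicator_eq] at h1
    have h2 : ε ^ 2 ≤ sinTheta (u (plant G C)) (cliqueIndicator C (block N k)) ^ 2 :=
      pow_le_pow_left₀ hε.le hG 2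
    have h3 : 1 / (A.card : ℝ) ≤ ε ^ 2 / 2 := by
      rw [div_le_iff₀ hAR]
      nlinarith [sq_nonneg ε, mul_le_mul_of_nonneg_left hA12.le (sq_nonneg ε)]
    have h4 : ε ^ 2 / 2 * (A.card * B.card) ≤
        noiseForm σ A B G (u (plant G C)) - noiseForm σ A B G (unitIndicator A) := by
      rw [← le_div_iff₀ hABpos]; linarith
    have h5 : 2 * t ≤ ε ^ 2 / 2 * (A.card * B.card) := by
      have := mul_le_mul_of_nonneg_left hAB (sq_nonneg ε)
      change 2 * (ε ^ 2 / 6912 * κ ^ 3) ≤ _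
      linarith
    by_contra! h
    linarith [h.1, h.2]
  have hup := card_noiseForm_ge_le hσ A B hI t hl hl'
    (fun G => t ≤ noiseForm σ A B G (u (plant G C))) fun G hG =>
      ⟨u (plant G C), by rw [← EuclideanSpace.real_norm_sq_eq, (hu _).1, one_pow], hG⟩
  have hlow := card_noiseForm_le_le hσ A B (unitIndicator A)
    (fun i hi => by simp [unitIndicator, hi]) (sum_unitIndicator_sq hA).le t hl (by linarith)
    (fun G => noiseForm σ A B G (unitIndicator A) ≤ -t) fun G hG => hG
  have hΩ : (0 : ℝ) < Fintype.card (Hypergraph3 N) := Nat.cast_pos.2 Fintype.card_pos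
  refine le_of_mul_le_mul_right ?_ hΩ
  rw [erdosRenyi_real_apply]
  have hcard : ((Finset.univ.filter (· ∈ S)).card : ℝ) ≤
      (Finset.univ.filter fun G => t ≤ noiseForm σ A B G (u (plant G C))).card +
      (Finset.univ.filter fun G => noiseForm σ A B G (unitIndicator A) ≤ -t).card := by
    have : Finset.univ.filter (· ∈ S) ⊆
        (Finset.univ.filter fun G => t ≤ noiseForm σ A B G (u (plant G C))) ∪
        Finset.univ.filter fun G => noiseForm σ A B G (unitIndicator A) ≤ -t := by
      intro G hG
      simpa using hsplit G (Finset.mem_filter.1 hG).2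
    exact_mod_cast (Finset.card_le_card this).trans (Finset.card_union_le _ _)
  refine hcard.trans ((add_le_add hup hlow).trans ?_)
  rw [← mul_assoc, ← add_mul]
  refine mul_le_mul_of_nonneg_right ?_ hΩ.le
  have h48 : (1 : ℝ) ≤ 48 ^ N := one_le_pow₀ (by norm_num)
  have hJ0 : (0 : ℝ) ≤ Fintype.card (∀ m : {m : Fin 3 // m ≠ k}, block N m) := Nat.cast_nonneg _
  have a1 : (48 : ℝ) ^ Fintype.card (block N k) * Real.exp
      (64 * l ^ 2 * (Fintype.card (∀ m : {m : Fin 3 // m ≠ k}, block N m) + A.card * B.card) -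
        l * t) ≤
      48 ^ N * Real.exp (64 * l ^ 2 * (N ^ 2 + κ ^ 3) - l * t) := by
    gcongr
    · norm_num
    · exact card_block_le N k
  have a2 : Real.exp (l ^ 2 * Fintype.card (∀ m : {m : Fin 3 // m ≠ k}, block N m) - l * t) ≤
      48 ^ N * Real.exp (64 * l ^ 2 * (N ^ 2 + κ ^ 3) - l * t) := by
    refine le_trans (Real.exp_le_exp.2 ?_) (le_mul_of_one_le_left (Real.exp_pos _).le h48)
    have b1 : l ^ 2 * Fintype.card (∀ m : {m : Fin 3 // m ≠ k}, block N m) ≤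
        l ^ 2 * N ^ 2 := by gcongr
    have b2 : 0 ≤ l ^ 2 * (N : ℝ) ^ 2 := by positivity
    have b3 : 0 ≤ l ^ 2 * (κ : ℝ) ^ 3 := by positivity
    linarith
  linarith

/-! ### Asymptotics -/

lemma tendsto_natCast_atTop_of_div_sqrt {κ : ℕ → ℕ}
    (hκ : Tendsto (fun N : ℕ => (κ N : ℝ) / √N) atTop atTop) :
    Tendsto (fun N => (κ N : ℝ)) atTop atTop := by
  refine tendsto_atTop_mono' atTop ?_ hκ
  filter_upwards [eventually_ge_atTop 1] with N hN
  exact div_le_self (Nat.cast_nonneg _) (Real.one_le_sqrt.2 (by exact_mod_cast hN))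

lemma eventually_exists_tilt {κ : ℕ → ℕ}
    (hκ : Tendsto (fun N : ℕ => (κ N : ℝ) / √N) atTop atTop) {δ : ℝ} (hδ : 0 < δ) :
    ∀ᶠ N : ℕ in atTop, ∃ l : ℝ, 0 ≤ l ∧ 16 * l ≤ 1 ∧
      48 ^ N * Real.exp (64 * l ^ 2 * (N ^ 2 + κ N ^ 3) - l * (δ * κ N ^ 3)) ≤
        Real.exp (-N) := by
  set a : ℝ := 6 / δ
  have ha : 0 < a := by positivity
  filter_upwards [eventually_ge_atTop 1, hκ.eventually_ge_atTop 1,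
    hκ.eventually_ge_atTop (16 * a), hκ.eventually_ge_atTop (128 * a ^ 2)] with N hN h1 h2 h3
  obtain ⟨ρ, hρ⟩ : ∃ ρ : ℝ, ρ = κ N / √N := ⟨_, rfl⟩
  rw [← hρ] at h1 h2 h3
  have hN1 : (1 : ℝ) ≤ N := by exact_mod_cast hN
  have hsN : 1 ≤ √(N : ℝ) := Real.one_le_sqrt.2 hN1
  obtain ⟨r, hr⟩ : ∃ r : ℝ, r = √(N : ℝ) := ⟨_, rfl⟩
  rw [← hr] at hsN hρ
  have hNr : (N : ℝ) = r ^ 2 := by rw [hr, Real.sq_sqrt (Nat.cast_nonneg N)]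
  have hr0 : 0 < r := by linarith
  have hρ0 : 0 < ρ := by linarith
  have hκr : (κ N : ℝ) = ρ * r := by rw [hρ]; field_simp
  have hρ3 : ρ ≤ ρ ^ 3 := le_self_pow₀ h1 (by norm_num)
  have hr3 : r ^ 2 ≤ r ^ 3 := pow_le_pow_right₀ hsN (by norm_num)
  have hκ3 : (0 : ℝ) < (κ N : ℝ) ^ 3 := by rw [hκr]; positivity
  -- The tilt is chosen so that the gain lδκ³ is 6N. The net costs at most 4N because 48 ≤ e⁴, and
  -- the variance term at most N once ρ ≥ 128a²; the balance is −N.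
  refine ⟨a * N / κ N ^ 3, by positivity, ?_, ?_⟩
  · rw [← mul_div_assoc, div_le_one hκ3, hκr, hNr, mul_pow, ← mul_assoc]
    exact mul_le_mul (h2.trans hρ3) hr3 (by positivity) (by positivity)
  · have e1 : a * N / κ N ^ 3 * (δ * κ N ^ 3) = 6 * N := by
      simp only [a]
      rw [div_mul_eq_mul_div, div_eq_iff hκ3.ne']
      field_simp
    have e2 : 64 * (a * N / κ N ^ 3) ^ 2 * ((N : ℝ) ^ 2 + κ N ^ 3) ≤ N := by
      have q1 : (N : ℝ) ^ 2 ≤ ρ ^ 3 * N ^ 2 := le_mul_of_one_le_left (by positivity)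
        (one_le_pow₀ h1)
      have hκN : (κ N : ℝ) ^ 3 = ρ ^ 3 * r * N := by rw [hκr, hNr]; ring
      have q2 : (N : ℝ) ^ 2 + κ N ^ 3 ≤ 2 * (ρ ^ 3 * N ^ 2) := by
        have : (κ N : ℝ) ^ 3 ≤ ρ ^ 3 * N ^ 2 := by
          rw [hκN, hNr]
          have : r ≤ r ^ 2 := le_self_pow₀ hsN (by norm_num)
          calc ρ ^ 3 * r * r ^ 2 ≤ ρ ^ 3 * r ^ 2 * r ^ 2 := by gcongr
            _ = _ := by ring
        linarith
      have q3 : ((κ N : ℝ) ^ 3) ^ 2 = ρ ^ 6 * N ^ 3 := by rw [hκN, hNr]; ring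
      calc 64 * (a * N / κ N ^ 3) ^ 2 * ((N : ℝ) ^ 2 + κ N ^ 3)
          ≤ 64 * (a * N / κ N ^ 3) ^ 2 * (2 * (ρ ^ 3 * N ^ 2)) := by gcongr
        _ = 128 * a ^ 2 * (N / ρ ^ 3) := by
            rw [div_pow, q3]
            field_simp
            ring
        _ ≤ ρ ^ 3 * (N / ρ ^ 3) := by
            gcongr
            exact h3.trans hρ3
        _ = N := by field_simp
    have e3 : (48 : ℝ) ^ N ≤ Real.exp (4 * N) := by
      rw [mul_comm, Real.exp_nat_mul]
      gcongr
      have : Real.exp 4 = Real.exp 1 ^ 4 := by rw [← Real.exp_nat_mul]; norm_num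
      rw [this]
      calc (48 : ℝ) ≤ 2.7 ^ 4 := by norm_num
        _ ≤ _ := by gcongr; linarith [Real.exp_one_gt_d9]
    rw [e1]
    calc (48 : ℝ) ^ N * Real.exp (64 * (a * N / κ N ^ 3) ^ 2 * (N ^ 2 + κ N ^ 3) - 6 * N)
        ≤ Real.exp (4 * N) * Real.exp (N - 6 * N) := by gcongr
      _ = Real.exp (-N) := by rw [← Real.exp_add]; ring_nf

lemma tendsto_plantedMeasure_sinTheta {κ : ℕ → ℕ} (hκ : ∀ N, κ N ≤ (firstHalf N).card)
    (hκ_lim : Tendsto (fun N : ℕ => (κ N : ℝ) / √N) atTop atTop)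
    {uhat : ∀ (N : ℕ) (k : Fin 3), Hypergraph3 N → EuclideanSpace ℝ (block N k)}
    (huhat : ∀ᶠ N in atTop, ∀ (k : Fin 3) (G : Hypergraph3 N),
      IsLeadingLeftSingularVector (signMatrix k G) (uhat N k G))
    (k : Fin 3) {ε : ℝ} (hε : 0 < ε) :
    Tendsto (fun N : ℕ => plantedMeasure (κ N) (firstHalf N) (hκ N)
      {ω | ε ≤ sinTheta (uhat N k (plant ω.1 ω.2)) (cliqueIndicator ω.2 (block N k))})
      atTop (𝓝 0) := by
  have hκ_top := tendsto_natCast_atTop_of_div_sqrt hκ_lim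
  have hlim : Tendsto (fun N : ℕ => ENNReal.ofReal (2 * Real.exp (-N) + 72 / κ N))
      atTop (𝓝 0) := by
    rw [← ENNReal.ofReal_zero]
    refine ENNReal.tendsto_ofReal ?_
    have h1 : Tendsto (fun N : ℕ => 2 * Real.exp (-(N : ℝ))) atTop (𝓝 (2 * 0)) :=
      (Real.tendsto_exp_neg_atTop_nhds_zero.comp tendsto_natCast_atTop_atTop).const_mul 2
    simpa using h1.add (hκ_top.const_div_atTop 72)
  refine tendsto_of_tendsto_of_tendsto_of_le_of_le' tendsto_const_nhds hlim
    (Eventually.of_forall fun _ => zero_le) ?_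
  filter_upwards [huhat, eventually_ge_atTop 12, hκ_top.eventually_ge_atTop 2,
    hκ_top.eventually_ge_atTop (24 / ε ^ 2),
    eventually_exists_tilt hκ_lim (show 0 < ε ^ 2 / 6912 by positivity)]
    with N hu hN hκ2 hκε ⟨l, hl, hl', hexp⟩
  have hκ2' : 2 ≤ κ N := by exact_mod_cast hκ2
  have hκε' : 24 ≤ ε ^ 2 * κ N := by
    rwa [div_le_iff₀ (by positivity), mul_comm] at hκε
  set S := {ω : Hypergraph3 N × Finset (Fin N) |
    ε ≤ sinTheta (uhat N k (plant ω.1 ω.2)) (cliqueIndicator ω.2 (block N k))}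
  -- Condition on C: balanced cliques have an exponentially small fibre, and the others are charged
  -- probability 1.
  have hfib : ∀ C, erdosRenyi N ((fun G => (G, C)) ⁻¹' S) ≤
      ENNReal.ofReal (2 * Real.exp (-N)) +
        {C : Finset (Fin N) | ¬ IsBalanced (κ N) C}.indicator 1 C := by
    intro C
    by_cases hC : IsBalanced (κ N) C
    · refine le_add_right ?_
      rw [← ofReal_measureReal]
      refine ENNReal.ofReal_le_ofReal ?_
      exact (hC.erdosRenyi_le_sinTheta_le (by omega) k (hu k) hε hκε' hl hl').trans
        (mul_le_mul_of_nonneg_left hexp (by norm_num))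
    · refine le_add_left ?_
      rw [Set.indicator_of_mem (by exact hC)]
      exact prob_le_one
  rw [plantedMeasure, Measure.prod_apply_symm .of_discrete]
  refine (lintegral_mono hfib).trans ?_
  rw [lintegral_add_left measurable_const, lintegral_const, measure_univ, mul_one,
    lintegral_indicator_one .of_discrete, ← ofReal_measureReal (μ := cliqueLaw _ _ _),
    ← ENNReal.ofReal_add (by positivity) measureReal_nonneg]
  exact ENNReal.ofReal_le_ofReal (add_le_add_right (cliqueLaw_not_isBalanced_le hN hκ2' (hκ N)) _)

/-- Nonnegative random variables that converge to `0` in probability converge to `0` in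
distribution, also when they live on different probability spaces. -/
lemma tendstoInDistribution_zero {Ω : ℕ → Type*} {m : ∀ N, MeasurableSpace (Ω N)}
    {μ : ∀ N, Measure (Ω N)} [∀ N, IsProbabilityMeasure (μ N)] {X : ∀ N, Ω N → ℝ}
    (hX : ∀ N, Measurable (X N)) (hX0 : ∀ N ω, 0 ≤ X N ω)
    (h : ∀ ε : ℝ, 0 < ε → Tendsto (fun N => μ N {ω | ε ≤ X N ω}) atTop (𝓝 0)) :
    TendstoInDistribution X atTop (fun _ : Unit => (0 : ℝ)) μ (Measure.dirac ()) where
  forall_aemeasurable N := (hX N).aemeasurable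
  aemeasurable_limit := aemeasurable_const
  tendsto := by
    -- Portmanteau criterion: the limit is a point mass at 0, so only open sets containing 0, hence
    -- a ball around it, impose a condition.
    refine tendsto_of_forall_isOpen_le_liminf' fun U hU => ?_
    simp only [ProbabilityMeasure.coe_mk]
    rw [Measure.map_dirac' measurable_const, Measure.dirac_apply' _ hU.measurableSet]
    by_cases h0 : (0 : ℝ) ∈ U
    · rw [Set.indicator_of_mem h0, Pi.one_apply]
      obtain ⟨ε, hε, hball⟩ := Metric.isOpen_iff.1 hU 0 h0
      have hlim : Tendsto (fun N => 1 - μ N {ω | ε ≤ X N ω}) atTop (𝓝 1) := by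
        simpa using ENNReal.Tendsto.sub (tendsto_const_nhds (x := (1 : ENNReal))) (h ε hε)
          (.inl ENNReal.one_ne_top)
      rw [← hlim.liminf_eq]
      refine liminf_le_liminf (Eventually.of_forall fun N => ?_)
      have hmeas : MeasurableSet {ω | ε ≤ X N ω} := measurableSet_le measurable_const (hX N)
      rw [Measure.map_apply (hX N) hU.measurableSet, ← prob_compl_eq_one_sub hmeas]
      refine measure_mono fun ω hω => hball ?_
      have : X N ω < ε := not_le.1 hω
      rw [Metric.mem_ball, Real.dist_eq, sub_zero, abs_of_nonneg (hX0 N ω)]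
      exact this
    · rw [Set.indicator_of_notMem h0]
      exact zero_le

/-- Transfers the tail bound from the sine to the angle by monotonicity of sin up to π/2. The
truncation at π/2 covers large ε, where sin ε need not be positive. -/
lemma sin_min_le_sinTheta {I : Type} [Fintype I] {u v : EuclideanSpace ℝ I} {ε : ℝ} (hε : 0 < ε)
    (h : ε ≤ principalAngle u v) : Real.sin (min ε (Real.pi / 2)) ≤ sinTheta u v := by
  have hle : principalAngle u v ≤ Real.pi / 2 := Real.arccos_le_pi_div_two.2 (by positivity)
  refine Real.sin_le_sin_of_le_of_le_pi_div_two ?_ hle ((min_le_left _ _).trans h)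
  have := Real.pi_pos
  have : 0 < min ε (Real.pi / 2) := lt_min hε (by linarith)
  linarith

end PlantedClique

theorem proposition1
    (κ : ℕ → ℕ)
    (hκ : ∀ N, κ N ≤ (PlantedClique.firstHalf N).card)
    (hκ_lim : Tendsto (fun N : ℕ => (κ N : ℝ) / Real.sqrt N) atTop atTop)
    (uhat : ∀ (N : ℕ) (k : Fin 3),
      PlantedClique.Hypergraph3 N → EuclideanSpace ℝ (PlantedClique.block N k))
    (huhat : ∀ᶠ N in atTop, ∀ (k : Fin 3) (G : PlantedClique.Hypergraph3 N),
      PlantedClique.IsLeadingLeftSingularVector (PlantedClique.signMatrix k G) (uhat N k G))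
    (k : Fin 3) :
    TendstoInDistribution
      (fun (N : ℕ) (ω : PlantedClique.Hypergraph3 N × Finset (Fin N)) =>
        PlantedClique.sinTheta (uhat N k (PlantedClique.plant ω.1 ω.2))
          (PlantedClique.cliqueIndicator ω.2 (PlantedClique.block N k)))
      atTop (fun _ : Unit => (0 : ℝ))
      (fun N => PlantedClique.plantedMeasure (κ N) (PlantedClique.firstHalf N) (hκ N))
      (Measure.dirac ()) ∧
    ∀ ε : ℝ, 0 < ε →
      Tendsto
        (fun N : ℕ =>
          PlantedClique.plantedMeasure (κ N) (PlantedClique.firstHalf N) (hκ N)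
            {ω | ε ≤ PlantedClique.principalAngle (uhat N k (PlantedClique.plant ω.1 ω.2))
              (PlantedClique.cliqueIndicator ω.2 (PlantedClique.block N k))})
        atTop (𝓝 0) := by
  have hsin := fun ε (hε : (0 : ℝ) < ε) =>
    PlantedClique.tendsto_plantedMeasure_sinTheta hκ hκ_lim huhat k hε
  refine ⟨PlantedClique.tendstoInDistribution_zero (fun N => .of_discrete)
    (fun N ω => PlantedClique.sinTheta_nonneg _ _) hsin, fun ε hε => ?_⟩
  have hpi := Real.pi_pos
  have hpos : 0 < Real.sin (min ε (Real.pi / 2)) :=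
    Real.sin_pos_of_pos_of_lt_pi (lt_min hε (by linarith))
      ((min_le_right _ _).trans_lt (by linarith))
  exact tendsto_of_tendsto_of_tendsto_of_le_of_le tendsto_const_nhds (hsin _ hpos)
    (fun _ => zero_le) fun N => measure_mono fun ω hω => PlantedClique.sin_min_le_sinTheta hε hω
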